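/- **Conventions.** Let $X$ be a poset, regarded as a category with a unique morphism $x\to y$ whenever $x\le y$, and let $\mathcal F\colon X\to\mathcal Ab$ be a functor to abelian groups. For $n\ge 0$ put $$C_n(X;\mathcal F)=\bigoplus_{\sigma=(\sigma_0<\dots<\sigma_n)}\mathcal F(\sigma_0),$$ the sum being over the chains $\sigma$ of $X$ of cardinality $n+1$. For $n\ge 1$ the differential $C_n(X;\mathcal F)\to C_{n-1}(X;\mathcal F)$ sends an element $a\in\mathcal F(\sigma_0)$ of the summand of $\sigma$ to $\sum_{i=0}^{n}(-1)^i\,\mathcal F\big(\sigma_0\le\min(\sigma\setminus\{\sigma_i\})\big)(a)$, where the $i$-th term lies in the summand of $\sigma\setminus\{\sigma_i\}$. For a subset $A\subseteq X$ let $H_n(X,A;\mathcal F)$ be the $n$-th homology group of the quotient complex $C(X;\mathcal F)/C(A;\mathcal F|_A)$. It is $0$ for $n<0$. **Theorem.** Let $L$ be a non-empty finite boolean lattice with top element $1$. For $x\in L$ let $\mathrm{rk}(x)$ be the largest $k$ such that there is a chain $x_0<x_1<\dots<x_k=x$ in $L$, and let $r=\mathrm{rk}(1)$ be the rank of $L$.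 Let $\phi=(\phi_1,\dots,\phi_r)\colon L\to\{0,1\}^r$ be any isomorphism of posets (at least one exists). If $y$ covers $x$ in $L$ (written $x\prec y$), there is a unique $m=m_{xy}$ with $\phi_m(x)=0$, $\phi_m(y)=1$, and $\phi_j(x)=\phi_j(y)$ for $j\neq m$; put $$\varepsilon(x\prec y)=\prod_{j=1}^{m_{xy}}(-1)^{\phi_j(x)}.$$ Let $\mathcal F\colon L\to\mathcal Ab$ be a functor. Let $\mathcal E$ be the chain complex with $E_n=\bigoplus_{x\in L,\ \mathrm{rk}(x)=r-n}\mathcal F(x)$ for $n\ge 0$ and $E_n=0$ for $n<0$, and with differentials $d_n\colon E_n\to E_{n-1}$ for $n\ge 1$ given by $$d_n(\lambda)=\sum_{y\,:\,x\prec y}\varepsilon(x\prec y)\,\mathcal F(x\le y)(\lambda)\qquad\text{for }\lambda\in\mathcal F(x),\ \mathrm{rk}(x)=r-n.$$ Then $$H_n(L,L\setminus\{1\};\mathcal F)\cong H_n(\mathcal E)\qquad\text{for all } n\in\mathbb Z.$$ -/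

import Mathlib

open CategoryTheory

universe u v

namespace PosetHomology

noncomputable section

/-! ### Homology of posets with functor coefficients -/

section Chains

variable {X : Type u} [Preorder X]

/-- The homomorphism `F(x ≤ y)`. -/
def transition (F : X ⥤ AddCommGrpCat.{v}) {x y : X} (h : x ≤ y) : F.obj x →+ F.obj y :=
  (F.map (homOfLE h)).hom

lemma transition_trans (F : X ⥤ AddCommGrpCat.{v}) {x y z : X} (h : x ≤ y) (h' : y ≤ z) :
    (transition F h').comp (transition F h) = transition F (h.trans h') := by
  unfold transition
  rw [← AddCommGrpCat.hom_comp, ← F.map_comp]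
  rfl

variable (X) in
/-- `n`-chains of a poset: chains `σ 0 < σ 1 < ⋯ < σ n` of cardinality `n + 1`.
The minimum of `σ` is `σ 0`. -/
abbrev Chain (n : ℕ) : Type u := Fin (n + 1) ↪o X

instance (n : ℕ) : DecidableEq (Chain X n) := Classical.decEq _

/-- The `i`-th face of a chain, obtained by removing its `i`-th element. -/
def Chain.face {n : ℕ} (σ : Chain X (n + 1)) (i : Fin (n + 2)) : Chain X n :=
  (Fin.succAboveOrderEmb i).trans σ

lemma Chain.zero_le_face {n : ℕ} (σ : Chain X (n + 1)) (i : Fin (n + 2)) :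
    σ 0 ≤ σ.face i 0 :=
  σ.monotone (Fin.zero_le _)

lemma Chain.face_face {n : ℕ} (σ : Chain X (n + 2)) (i : Fin (n + 3)) (j : Fin (n + 2)) :
    (σ.face (i.succAbove j)).face (j.predAbove i) = (σ.face i).face j := by
  ext k
  exact congrArg σ (Fin.succAbove_succAbove_succAbove_predAbove i j k)

variable (F : X ⥤ AddCommGrpCat.{v})

/-- `C_n(X; F)`, the direct sum of the groups `F (min σ)` over the `n`-chains `σ` of `X`. -/
abbrev ChainGroup (n : ℕ) : Type (max u v) :=
  DirectSum (Chain X n) fun σ => F.obj (σ 0)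

/-- The differential `C_{n+1}(X; F) → C_n(X; F)`. It sends `a ∈ F (min σ)` to the alternating sum
over `i` of the elements `F (min σ ≤ min (∂ᵢ σ)) a` in the summands of the faces `∂ᵢ σ`. -/
def boundary (n : ℕ) : ChainGroup F (n + 1) →+ ChainGroup F n :=
  DirectSum.toAddMonoid fun σ => ∑ i : Fin (n + 2), (-1 : ℤ) ^ (i : ℕ) •
    (DirectSum.of (fun τ : Chain X n => F.obj (τ 0)) (σ.face i)).comp
      (transition F (σ.zero_le_face i))

lemma boundary_of (n : ℕ) (σ : Chain X (n + 1)) (a : F.obj (σ 0)) :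
    boundary F n (DirectSum.of (fun τ : Chain X (n + 1) => F.obj (τ 0)) σ a) =
      ∑ i : Fin (n + 2), (-1 : ℤ) ^ (i : ℕ) •
        DirectSum.of (fun τ : Chain X n => F.obj (τ 0)) (σ.face i)
          (transition F (σ.zero_le_face i) a) := by
  simp [boundary]

lemma of_congr {n : ℕ} {x : X} (a : F.obj x) {σ τ : Chain X n} (h : σ = τ) (hσ : x ≤ σ 0)
    (hτ : x ≤ τ 0) :
    DirectSum.of (fun τ : Chain X n => F.obj (τ 0)) σ (transition F hσ a) =
      DirectSum.of (fun τ : Chain X n => F.obj (τ 0)) τ (transition F hτ a) := by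
  subst h; rfl

lemma boundary_boundary (n : ℕ) : (boundary F n).comp (boundary F (n + 1)) = 0 := by
  refine DirectSum.addHom_ext fun σ a => ?_
  simp only [AddMonoidHom.comp_apply, AddMonoidHom.zero_apply, boundary_of, map_sum, map_zsmul,
    Finset.smul_sum, smul_smul, ← pow_add]
  simp only [← AddMonoidHom.comp_apply (transition F _) (transition F _), transition_trans]
  rw [← Finset.sum_product' Finset.univ Finset.univ
    (fun (i : Fin (n + 3)) (j : Fin (n + 2)) => (-1 : ℤ) ^ ((i : ℕ) + (j : ℕ)) •
      DirectSum.of (fun τ : Chain X n => F.obj (τ 0)) ((σ.face i).face j)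
        (transition F ((σ.zero_le_face i).trans ((σ.face i).zero_le_face j)) a))]
  refine Finset.sum_ninvolution (fun p => (p.1.succAbove p.2, p.2.predAbove p.1)) ?_ ?_ ?_ ?_
  · rintro ⟨i, j⟩
    dsimp only
    rw [Fin.neg_one_pow_succAbove_add_predAbove,
      of_congr F a (σ.face_face i j) _
        ((σ.zero_le_face i).trans ((σ.face i).zero_le_face j)), neg_smul, add_neg_cancel]
  · rintro ⟨i, j⟩ - h
    exact Fin.succAbove_ne i j (congrArg Prod.fst h)
  · simp
  · rintro ⟨i, j⟩
    simp [Fin.succAbove_succAbove_predAbove, Fin.predAbove_predAbove_succAbove]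

/-- The chain complex `C(X; F)`. -/
def chainComplex : ChainComplex AddCommGrpCat.{max u v} ℕ :=
  ChainComplex.of (fun n => AddCommGrpCat.of (ChainGroup F n))
    (fun n => AddCommGrpCat.ofHom (boundary F n))
    (fun n => by
      rw [← AddCommGrpCat.ofHom_comp, boundary_boundary]
      rfl)

lemma chainComplex_d (n : ℕ) :
    (chainComplex F).d (n + 1) n = AddCommGrpCat.ofHom (boundary F n) :=
  ChainComplex.of_d (fun n => AddCommGrpCat.of (ChainGroup F n))
    (fun n => AddCommGrpCat.ofHom (boundary F n)) n

/-- The restriction `F|_A` of a functor to a subposet. -/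
def restrict (A : Set X) : A ⥤ AddCommGrpCat.{v} :=
  (Subtype.mono_coe (· ∈ A)).functor ⋙ F

/-- A chain of a subposet `A`, seen as a chain of `X`. -/
def Chain.incl (A : Set X) {n : ℕ} (σ : Chain A n) : Chain X n :=
  σ.trans (OrderEmbedding.subtype (· ∈ A))

/-- The group `F|_A (min σ)` is the group `F (min σ)`. -/
def restrictId (A : Set X) {n : ℕ} (σ : Chain A n) :
    (restrict F A).obj (σ 0) →+ F.obj (Chain.incl A σ 0) :=
  AddMonoidHom.id (F.obj (σ 0 : X))

/-- The inclusion `C_n(A; F|_A) → C_n(X; F)`. -/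
def inclusionHom (A : Set X) (n : ℕ) : ChainGroup (restrict F A) n →+ ChainGroup F n :=
  DirectSum.toAddMonoid fun σ =>
    (DirectSum.of (fun τ : Chain X n => F.obj (τ 0)) (Chain.incl A σ)).comp (restrictId F A σ)

lemma inclusionHom_of (A : Set X) (n : ℕ) (σ : Chain A n) (a : (restrict F A).obj (σ 0)) :
    inclusionHom F A n (DirectSum.of (fun τ : Chain A n => (restrict F A).obj (τ 0)) σ a) =
      DirectSum.of (fun τ : Chain X n => F.obj (τ 0)) (Chain.incl A σ)
        (restrictId F A σ a) := by
  simp [inclusionHom]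

lemma inclusionHom_comm (A : Set X) (n : ℕ) :
    (boundary F n).comp (inclusionHom F A (n + 1)) =
      (inclusionHom F A n).comp (boundary (restrict F A) n) := by
  refine DirectSum.addHom_ext fun σ a => ?_
  rw [AddMonoidHom.comp_apply, AddMonoidHom.comp_apply, inclusionHom_of, boundary_of, boundary_of,
    map_sum]
  refine Finset.sum_congr rfl fun i _ => ?_
  rw [map_zsmul, inclusionHom_of]
  rfl

/-- The inclusion of chain complexes `C(A; F|_A) → C(X; F)`. -/
def inclusion (A : Set X) : chainComplex (restrict F A) ⟶ chainComplex F :=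
  ChainComplex.ofHom (fun n => AddCommGrpCat.ofHom (inclusionHom F A n))
    (fun n => by
      rw [chainComplex_d, chainComplex_d]
      exact congrArg AddCommGrpCat.ofHom (inclusionHom_comm F A n))

/-- The relative chain complex `C(X, A; F) = C(X; F) / C(A; F|_A)`. -/
def relativeComplex (A : Set X) : ChainComplex AddCommGrpCat.{max u v} ℕ :=
  Limits.cokernel (inclusion F A)

end Chains

/-- The embedding of the non-negative degrees in the integers. -/
def natToInt : ComplexShape.Embedding (ComplexShape.down ℕ) (ComplexShape.down ℤ) :=
  ComplexShape.Embedding.mk' _ _ (fun n => (n : ℤ)) Nat.cast_injective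
    (fun i j => by simp only [ComplexShape.down_Rel]; norm_cast)

/-- The homology in degree `n ∈ ℤ` of a non-negatively graded chain complex, which is extended by
zero in the negative degrees. -/
def homologyInt (K : ChainComplex AddCommGrpCat.{u} ℕ) (n : ℤ) : AddCommGrpCat.{u} :=
  (K.extend natToInt).homology n

/-- The relative homology group `H_n(X, A; F)`. -/
def relativeHomology {X : Type u} [Preorder X] (F : X ⥤ AddCommGrpCat.{v}) (A : Set X)
    (n : ℤ) : AddCommGrpCat.{max u v} :=
  homologyInt (relativeComplex F A) n

/-! ### The cube complex of a finite boolean lattice -/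

/-- The rank of an element `x`: the height of the poset `{y | y ≤ x}`, that is, the maximal `k`
such that there is a chain `x₀ < x₁ < ⋯ < x_k = x`. -/
def rank {L : Type u} [Preorder L] (x : L) : ℕ := (Order.height x).toNat

section Cube

variable {L : Type u} [BooleanAlgebra L] {r : ℕ}

lemma exists_flip (φ : L ≃o (Fin r → Bool)) {x y : L} (h : x ⋖ y) :
    ∃ m : Fin r, φ x m = false ∧ φ y m = true ∧ ∀ j ≠ m, φ x j = φ y j := by
  have h' : φ x ⋖ φ y := (apply_covBy_apply_iff φ).2 h
  obtain ⟨m, hm, hj⟩ := Pi.covBy_iff.1 h'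
  have hlt := hm.lt
  refine ⟨m, ?_, ?_, fun j hne => hj j hne⟩ <;>
  · revert hlt; cases φ x m <;> cases φ y m <;> decide

/-- The coordinate `m_{xy}` that changes from `0` to `1` along the cover relation `x ⋖ y`. -/
def flipIndex (φ : L ≃o (Fin r → Bool)) {x y : L} (h : x ⋖ y) : Fin r :=
  (exists_flip φ h).choose

/-- The sign `ε(x ⋖ y) = ∏_{j ≤ m_{xy}} (-1) ^ φ_j(x)`. -/
def sign (φ : L ≃o (Fin r → Bool)) {x y : L} (h : x ⋖ y) : ℤ :=
  ∏ j ∈ Finset.Iic (flipIndex φ h), (-1) ^ (φ x j).toNat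

lemma flipIndex_spec (φ : L ≃o (Fin r → Bool)) {x y : L} (h : x ⋖ y) :
    φ x (flipIndex φ h) = false ∧ φ y (flipIndex φ h) = true ∧
      ∀ j ≠ flipIndex φ h, φ x j = φ y j :=
  (exists_flip φ h).choose_spec

lemma flipIndex_eq (φ : L ≃o (Fin r → Bool)) {x y : L} (h : x ⋖ y) {m : Fin r}
    (hm : φ x m ≠ φ y m) : flipIndex φ h = m := by
  by_contra hne
  exact hm ((flipIndex_spec φ h).2.2 m (Ne.symm hne))

lemma covBy_of_flip (φ : L ≃o (Fin r → Bool)) {x y : L} {m : Fin r} (hx : φ x m = false)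
    (hy : φ y m = true) (h : ∀ j ≠ m, φ x j = φ y j) : x ⋖ y := by
  refine (apply_covBy_apply_iff φ).1 (Pi.covBy_iff.2 ⟨m, ?_, h⟩)
  rw [hx, hy]
  exact bot_covBy_top

lemma prod_sign_flip (φ : L ≃o (Fin r → Bool)) {x y : L} {m : Fin r} (hx : φ x m = false)
    (hy : φ y m = true) (h : ∀ j ≠ m, φ x j = φ y j) (k : Fin r) :
    ∏ j ∈ Finset.Iic k, (-1 : ℤ) ^ (φ y j).toNat =
      (if m ≤ k then -1 else 1) * ∏ j ∈ Finset.Iic k, (-1 : ℤ) ^ (φ x j).toNat := by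
  have key (j : Fin r) : (-1 : ℤ) ^ (φ y j).toNat =
      (if m = j then -1 else 1) * (-1 : ℤ) ^ (φ x j).toNat := by
    by_cases hj : m = j
    · subst hj; simp [hx, hy]
    · simp [hj, h j (Ne.symm hj)]
  simp_rw [key]
  rw [Finset.prod_mul_distrib, Finset.prod_ite_eq]
  simp

/-- The fourth vertex of the square spanned by `x ⋖ y ⋖ z`. -/
def opposite (φ : L ≃o (Fin r → Bool)) (x y z : L) : L :=
  φ.symm fun j => φ x j || (φ z j && !φ y j)

lemma opposite_apply (φ : L ≃o (Fin r → Bool)) (x y z : L) (j : Fin r) :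
    φ (opposite φ x y z) j = (φ x j || (φ z j && !φ y j)) := by
  simp [opposite]

lemma opposite_opposite (φ : L ≃o (Fin r → Bool)) {x y z : L} (hxy : x ≤ y) (hyz : y ≤ z) :
    opposite φ x (opposite φ x y z) z = y := by
  apply φ.injective
  funext j
  have h1 : φ x j ≤ φ y j := φ.monotone hxy j
  have h2 : φ y j ≤ φ z j := φ.monotone hyz j
  rw [opposite_apply, opposite_apply]
  revert h1 h2
  cases φ x j <;> cases φ y j <;> cases φ z j <;> decide

lemma square (φ : L ≃o (Fin r → Bool)) {x y z : L} (hxy : x ⋖ y) (hyz : y ⋖ z) :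
    ∃ (h : x ⋖ opposite φ x y z) (h' : opposite φ x y z ⋖ z), opposite φ x y z ≠ y ∧
      sign φ h * sign φ h' = -(sign φ hxy * sign φ hyz) := by
  obtain ⟨a1, a2, a3⟩ := flipIndex_spec φ hxy
  obtain ⟨b1, b2, b3⟩ := flipIndex_spec φ hyz
  set m := flipIndex φ hxy with hm
  set k := flipIndex φ hyz with hk
  have hmk : m ≠ k := by
    intro h
    rw [← h, a2] at b1
    exact Bool.noConfusion b1
  have ck : φ (opposite φ x y z) k = true := by simp [opposite_apply, b1, b2]
  have cm : φ (opposite φ x y z) m = false := by simp [opposite_apply, a1, a2]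
  have cx : ∀ j ≠ k, φ x j = φ (opposite φ x y z) j := fun j hj => by
    rw [opposite_apply, b3 j hj]; simp
  have cz : ∀ j ≠ m, φ (opposite φ x y z) j = φ z j := fun j hj => by
    have h2 : φ y j ≤ φ z j := φ.monotone hyz.le j
    rw [opposite_apply, a3 j hj]
    revert h2
    cases φ y j <;> cases φ z j <;> decide
  have xk : φ x k = false := (a3 k hmk.symm).trans b1
  have zm : φ z m = true := (b3 m hmk).symm.trans a2
  have h := covBy_of_flip φ xk ck cx
  have h' := covBy_of_flip φ cm zm cz
  have e1 : flipIndex φ h = k := flipIndex_eq φ h (by rw [xk, ck]; decide)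
  have e2 : flipIndex φ h' = m := flipIndex_eq φ h' (by rw [cm, zm]; decide)
  refine ⟨h, h', fun e => ?_, ?_⟩
  · rw [e, a2] at cm
    exact Bool.noConfusion cm
  · unfold sign
    rw [e1, e2, ← hm, ← hk, prod_sign_flip φ xk ck cx m, prod_sign_flip φ a1 a2 a3 k]
    rcases lt_or_gt_of_ne hmk with hlt | hlt
    · rw [if_neg (not_le.2 hlt), if_pos hlt.le]; ring
    · rw [if_pos hlt.le, if_neg (not_le.2 hlt)]; ring

/-- The rank of `x` is the number of its coordinates equal to `1`. -/
lemma rank_eq_card (φ : L ≃o (Fin r → Bool)) (x : L) :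
    rank x = (Finset.univ.filter fun j => φ x j = true).card := by
  let c : L → ℕ := fun x => (Finset.univ.filter fun j => φ x j = true).card
  have hc : StrictMono c := by
    intro x y hxy
    refine Finset.card_lt_card ⟨fun j hj => ?_, fun hsub => hxy.not_ge ?_⟩
    · have hle : φ x j ≤ φ y j := φ.monotone hxy.le j
      simp only [Finset.mem_filter, Finset.mem_univ, true_and] at hj ⊢
      rw [hj] at hle
      exact top_le_iff.1 hle
    · refine φ.le_iff_le.1 fun j => ?_
      by_cases hj : φ y j = true
      · have := hsub (Finset.mem_filter.2 ⟨Finset.mem_univ j, hj⟩)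
        rw [(Finset.mem_filter.1 this).2]
        exact le_top
      · rw [Bool.eq_false_of_not_eq_true hj]
        exact bot_le
  have upper : Order.height x ≤ c x := by
    simpa using Order.height_le_height_apply_of_strictMono c hc x
  have lower : ∀ (n : ℕ) (x : L), c x = n → (n : ℕ∞) ≤ Order.height x := by
    intro n
    induction n with
    | zero => simp
    | succ n ih =>
      intro x hx
      obtain ⟨m, hm⟩ : (Finset.univ.filter fun j => φ x j = true).Nonempty := by
        rw [← Finset.card_pos]; change 0 < c x; omega
      have hm' : φ x m = true := (Finset.mem_filter.1 hm).2
      let y : L := φ.symm (Function.update (φ x) m false)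
      have hy : φ y = Function.update (φ x) m false := φ.apply_symm_apply _
      have hcov : y ⋖ x := by
        refine covBy_of_flip φ (m := m) (by simp [hy]) hm' fun j hj => ?_
        rw [hy, Function.update_of_ne hj]
      have hcy : c y = n := by
        have : (Finset.univ.filter fun j => φ y j = true) =
            (Finset.univ.filter fun j => φ x j = true).erase m := by
          ext j
          by_cases hj : j = m
          · subst hj; simp [hy]
          · simp [hy, hj]
        change (Finset.univ.filter fun j => φ y j = true).card = n
        rw [this, Finset.card_erase_of_mem hm]
        change c x - 1 = n
        omega
      push_cast
      exact (add_le_add_left (ih y hcy) 1).trans (Order.height_add_one_le hcov.lt)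
  have := le_antisymm upper (lower _ x rfl)
  unfold rank
  rw [this]
  rfl

lemma rank_covBy (φ : L ≃o (Fin r → Bool)) {x y : L} (h : x ⋖ y) : rank y = rank x + 1 := by
  rw [rank_eq_card φ, rank_eq_card φ]
  obtain ⟨a1, a2, a3⟩ := flipIndex_spec φ h
  have : (Finset.univ.filter fun j => φ y j = true) =
      insert (flipIndex φ h) (Finset.univ.filter fun j => φ x j = true) := by
    ext j
    by_cases hj : j = flipIndex φ h
    · rw [hj]; simp [a2]
    · simp [hj, a3 j hj]
  rw [this, Finset.card_insert_of_notMem (by simp [a1])]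

variable (L) in
/-- Every finite boolean lattice `L` is isomorphic to the cube `{0, 1} ^ rk(L)`. -/
lemma exists_cubeIso [Finite L] : Nonempty (L ≃o (Fin (rank (⊤ : L)) → Bool)) := by
  classical
  have := Fintype.ofFinite L
  let e : L ≃o Set {a : L // IsAtom a} :=
    letI := Fintype.toCompleteAtomicBooleanAlgebra L
    CompleteAtomicBooleanAlgebra.toSetOfIsAtom
  let f := Fintype.equivFin {a : L // IsAtom a}
  let g : Set {a : L // IsAtom a} ≃o (Fin (Fintype.card {a : L // IsAtom a}) → Bool) :=
    { toFun := fun s j => decide (f.symm j ∈ s)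
      invFun := fun c => {a | c (f a) = true}
      left_inv := fun s => by ext a; simp
      right_inv := fun c => by funext j; simp
      map_rel_iff' := fun {s t} => by
        simp only [Equiv.coe_fn_mk, Pi.le_def, Bool.le_iff_imp, decide_eq_true_eq]
        exact ⟨fun h a ha => by simpa using h (f a) (by simpa using ha), fun h j hj => h hj⟩ }
  have hr : rank (⊤ : L) = Fintype.card {a : L // IsAtom a} := by
    rw [rank_eq_card (e.trans g)]
    simp
  rw [hr]
  exact ⟨e.trans g⟩

variable (L) in
/-- `D_n`, the set of the elements of rank `r - n`, where `r` is the rank of `L`. -/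
abbrev Level (n : ℕ) : Type u := {x : L // rank x + n = rank (⊤ : L)}

instance (n : ℕ) : DecidableEq (Level L n) := Classical.decEq _

/-- An element that covers an element of `D_{n+1}` lies in `D_n`. -/
abbrev Level.cover (φ : L ≃o (Fin r → Bool)) {n : ℕ} (x : Level L (n + 1))
    (y : {y : L // x.1 ⋖ y}) : Level L n :=
  ⟨y.1, by have := x.2; rw [rank_covBy φ y.2]; omega⟩

/-- `E_n`, the direct sum of the groups `F(x)` over the elements `x` of `D_n`. -/
abbrev CubeGroup (F : L ⥤ AddCommGrpCat.{v}) (n : ℕ) : Type (max u v) :=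
  DirectSum (Level L n) fun x => F.obj x.1

variable [Finite L]

instance (x : L) : Fintype {y : L // x ⋖ y} := Fintype.ofFinite _

/-- The differential `E_{n+1} → E_n`. It sends `a ∈ F(x)` to the sum of the elements
`ε(x ⋖ y) F(x ≤ y)(a)` over the elements `y` that cover `x`. -/
def cubeBoundary (φ : L ≃o (Fin r → Bool)) (F : L ⥤ AddCommGrpCat.{v}) (n : ℕ) :
    CubeGroup F (n + 1) →+ CubeGroup F n :=
  DirectSum.toAddMonoid fun x => ∑ y : {y : L // x.1 ⋖ y}, sign φ y.2 •
    (DirectSum.of (fun z : Level L n => F.obj z.1) (x.cover φ y)).comp (transition F y.2.le)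

lemma cubeBoundary_of (φ : L ≃o (Fin r → Bool)) (F : L ⥤ AddCommGrpCat.{v}) (n : ℕ)
    (x : Level L (n + 1)) (a : F.obj x.1) :
    cubeBoundary φ F n (DirectSum.of (fun z : Level L (n + 1) => F.obj z.1) x a) =
      ∑ y : {y : L // x.1 ⋖ y}, sign φ y.2 •
        DirectSum.of (fun z : Level L n => F.obj z.1) (x.cover φ y)
          (transition F y.2.le a) := by
  simp [cubeBoundary]

lemma cubeBoundary_cubeBoundary (φ : L ≃o (Fin r → Bool)) (F : L ⥤ AddCommGrpCat.{v}) (n : ℕ) :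
    (cubeBoundary φ F n).comp (cubeBoundary φ F (n + 1)) = 0 := by
  refine DirectSum.addHom_ext fun x a => ?_
  have expand : ((cubeBoundary φ F n).comp (cubeBoundary φ F (n + 1)))
      (DirectSum.of (fun z : Level L (n + 2) => F.obj z.1) x a) =
      ∑ p : (y : {y : L // x.1 ⋖ y}) × {z : L // y.1 ⋖ z}, (sign φ p.1.2 * sign φ p.2.2) •
        DirectSum.of (fun z : Level L n => F.obj z.1) ((x.cover φ p.1).cover φ p.2)
          (transition F (p.1.2.le.trans p.2.2.le) a) := by
    rw [AddMonoidHom.comp_apply, cubeBoundary_of, map_sum, Fintype.sum_sigma]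
    refine Finset.sum_congr rfl fun y _ => ?_
    rw [map_zsmul, cubeBoundary_of, Finset.smul_sum]
    refine Finset.sum_congr rfl fun z _ => ?_
    rw [smul_smul, ← transition_trans F y.2.le z.2.le]
    rfl
  refine Eq.trans expand ?_
  refine Finset.sum_ninvolution
    (fun p => ⟨⟨opposite φ x.1 p.1.1 p.2.1, (square φ p.1.2 p.2.2).choose⟩,
      ⟨p.2.1, (square φ p.1.2 p.2.2).choose_spec.choose⟩⟩) ?_ ?_ ?_ ?_
  · rintro ⟨y, z⟩
    have h := (square φ y.2 z.2).choose_spec.choose_spec.2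
    dsimp only
    rw [h, neg_smul]
    exact add_neg_cancel _
  · rintro ⟨y, z⟩ - h
    exact (square φ y.2 z.2).choose_spec.choose_spec.1 (congrArg (fun p => p.1.1) h)
  · simp
  · rintro ⟨⟨y, hy⟩, ⟨z, hz⟩⟩
    have h := opposite_opposite φ hy.le hz.le
    have aux : ∀ (y' : L) (hy' : x.1 ⋖ y') (hz' : y' ⋖ z), y' = y →
        (⟨⟨y', hy'⟩, ⟨z, hz'⟩⟩ : (y : {y : L // x.1 ⋖ y}) × {z : L // y.1 ⋖ z}) =
          ⟨⟨y, hy⟩, ⟨z, hz⟩⟩ := by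
      rintro _ _ _ rfl; rfl
    exact aux _ _ _ h

/-- The chain complex `E` of a functor on a finite boolean lattice, with respect to an isomorphism
`φ` with the cube. -/
def cubeComplex (φ : L ≃o (Fin (rank (⊤ : L)) → Bool)) (F : L ⥤ AddCommGrpCat.{v}) :
    ChainComplex AddCommGrpCat.{max u v} ℕ :=
  ChainComplex.of (fun n => AddCommGrpCat.of (CubeGroup F n))
    (fun n => AddCommGrpCat.ofHom (cubeBoundary φ F n))
    (fun n => by
      rw [← AddCommGrpCat.ofHom_comp, cubeBoundary_cubeBoundary]
      rfl)

end Cube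

end

end PosetHomology

/-! Both complexes have the form `F ⊗ P` for a complex `P` of free contravariant functors on the
poset. A basis element with label `y` stands for the functor that is `ℤ` on the elements `≤ y` and
`0` elsewhere; the value of `P` at `x` is spanned by the basis elements with label at least `x`
(`above`), and tensoring with `F` is `realize`. For the relative complex the basis consists of the
chains ending at `⊤`, labelled by their minimum (`relativeComplexIso`); for the cube complex it
consists of the elements of `L`, labelled by themselves.

In both cases `P` is a free resolution of the functor that is `ℤ` at `⊤` and `0` elsewhere. The
label `⊤` occurs exactly once, in degree zero, and at each `x ≠ ⊤` the value of `P` is contractible.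
For chains, the contraction prepends `x` (`acyclicOff_topLabelled`). For the cube, it deletes a
coordinate that is `0` in `x` (`acyclicOff_cubeLabelled`); the signs work out because the squares of
the cube anticommute.

The comparison theorem for projective resolutions then gives a homotopy equivalence by maps that
respect labels, and tensoring with `F` preserves it (`LabelledComplex.nonempty_homotopyEquiv`). -/

namespace PosetHomology

noncomputable section

/-! ### Label-preserving maps of free abelian groups -/

section Labelled

variable {X : Type u} [Preorder X] {I J K : Type*} {μ : I → X} {ν : J → X} {ξ : K → X}

/-- The vectors of `ℤ^(J)` supported on the indices with label at least `x`. -/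
def above (ν : J → X) (x : X) : Submodule ℤ (J →₀ ℤ) :=
  Finsupp.supported ℤ ℤ {j | x ≤ ν j}

lemma single_mem_above {x : X} {j : J} (h : x ≤ ν j) (c : ℤ) :
    Finsupp.single j c ∈ above ν x :=
  Finsupp.single_mem_supported ℤ c h

/-- This makes `above ν` a contravariant functor of `x`. -/
lemma above_anti {x y : X} (h : x ≤ y) : above ν y ≤ above ν x :=
  Finsupp.supported_mono fun _ hj => h.trans hj

-- The formulas for `spread` and `realize` hold only on `above ν x`, because `spread` discards basis
-- vectors whose label is not above `x`. Their proofs therefore reduce to the basis vectors of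
-- `above ν x`.
@[elab_as_elim]
lemma above_induction {x : X} {p : ∀ c : J →₀ ℤ, c ∈ above ν x → Prop}
    (single : ∀ j (h : x ≤ ν j), p (.single j 1) (single_mem_above h 1))
    (zero : p 0 (zero_mem _))
    (add : ∀ a b ha hb, p a ha → p b hb → p (a + b) (add_mem ha hb))
    (smul : ∀ (m : ℤ) a ha, p a ha → p (m • a) (Submodule.smul_mem _ m ha))
    {c : J →₀ ℤ} (hc : c ∈ above ν x) : p c hc := by
  suffices h : ∃ h, p c h from h.2
  rw [above, Finsupp.supported_eq_span_single] at hc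
  induction hc using Submodule.span_induction with
  | mem _ h => obtain ⟨j, hj, rfl⟩ := h; exact ⟨_, single j hj⟩
  | zero => exact ⟨_, zero⟩
  | add _ _ _ _ h h' => exact ⟨_, add _ _ _ _ h.2 h'.2⟩
  | smul m _ _ h => exact ⟨_, smul m _ _ h.2⟩

/-- A linear map between labelled free groups that does not decrease labels. -/
def Respects (μ : I → X) (ν : J → X) (f : (I →₀ ℤ) →ₗ[ℤ] (J →₀ ℤ)) : Prop :=
  ∀ i, f (Finsupp.single i 1) ∈ above ν (μ i)

/-- Such a map is a natural transformation from `above μ` to `above ν`; as in Yoneda's lemma, a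
condition at the label of each basis vector suffices. -/
lemma Respects.map_mem {f : (I →₀ ℤ) →ₗ[ℤ] (J →₀ ℤ)} (hf : Respects μ ν f) {x : X}
    {c : I →₀ ℤ} (hc : c ∈ above μ x) : f c ∈ above ν x := by
  induction hc using above_induction with
  | single i h => exact above_anti h (hf i)
  | zero => simp
  | add a b _ _ ha hb => rw [map_add]; exact add_mem ha hb
  | smul m a _ ha => rw [map_smul]; exact Submodule.smul_mem _ _ ha

lemma Respects.comp {g : (J →₀ ℤ) →ₗ[ℤ] (K →₀ ℤ)} {f : (I →₀ ℤ) →ₗ[ℤ] (J →₀ ℤ)}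
    (hg : Respects ν ξ g) (hf : Respects μ ν f) : Respects μ ξ (g ∘ₗ f) :=
  fun i => hg.map_mem (hf i)

lemma Respects.id : Respects μ μ LinearMap.id :=
  fun _ => single_mem_above le_rfl 1

lemma Respects.zero : Respects μ ν 0 := fun _ => zero_mem _

lemma Respects.sub {f g : (I →₀ ℤ) →ₗ[ℤ] (J →₀ ℤ)} (hf : Respects μ ν f)
    (hg : Respects μ ν g) : Respects μ ν (f - g) :=
  fun i => sub_mem (hf i) (hg i)

variable (F : X ⥤ AddCommGrpCat.{v}) [DecidableEq I] [DecidableEq J] [DecidableEq K]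

/-- The homomorphism `F(x) → ⨁ F(ν j)` with integral coefficients `c`. -/
def spread (ν : J → X) (x : X) :
    (J →₀ ℤ) →ₗ[ℤ] (F.obj x →+ DirectSum J fun j => F.obj (ν j)) :=
  open Classical in
  Finsupp.linearCombination ℤ fun j => if h : x ≤ ν j then
    (DirectSum.of (fun j => F.obj (ν j)) j).comp (transition F h) else 0

lemma spread_single {x : X} {j : J} (h : x ≤ ν j) (a : F.obj x) :
    spread F ν x (Finsupp.single j 1) a =
      DirectSum.of (fun j => F.obj (ν j)) j (transition F h a) := by
  simp [spread, h]

lemma transition_refl {x : X} (h : x ≤ x) (a : F.obj x) : transition F h a = a := by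
  simp [transition]

lemma spread_single_self (j : J) (a : F.obj (ν j)) :
    spread F ν (ν j) (Finsupp.single j 1) a = DirectSum.of (fun j => F.obj (ν j)) j a := by
  rw [spread_single F le_rfl, transition_refl]

/-- On a basis vector both sides are the transition from `x` to its label. Without `hc` the left
side could lose terms whose label is above `x` but not above `y`. -/
lemma spread_transition {x y : X} (h : x ≤ y) {c : J →₀ ℤ} (hc : c ∈ above ν y) (a : F.obj x) :
    spread F ν y c (transition F h a) = spread F ν x c a := by
  induction hc using above_induction with
  | single j hj =>
    rw [spread_single F hj, spread_single F (h.trans hj), ← transition_trans F h hj]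
    rfl
  | zero => simp
  | add a b _ _ ha hb => simp [ha, hb]
  | smul m a _ ha => rw [map_smul, map_smul, AddMonoidHom.smul_apply, AddMonoidHom.smul_apply, ha]

/-- The homomorphism `⨁ F(μ i) → ⨁ F(ν j)` given by the matrix of `f`. -/
def realize (μ : I → X) (ν : J → X) (f : (I →₀ ℤ) →ₗ[ℤ] (J →₀ ℤ)) :
    (DirectSum I fun i => F.obj (μ i)) →+ DirectSum J fun j => F.obj (ν j) :=
  DirectSum.toAddMonoid fun i => spread F ν (μ i) (f (Finsupp.single i 1))

lemma realize_of (f : (I →₀ ℤ) →ₗ[ℤ] (J →₀ ℤ)) (i : I) (a : F.obj (μ i)) :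
    realize F μ ν f (DirectSum.of (fun i => F.obj (μ i)) i a) =
      spread F ν (μ i) (f (Finsupp.single i 1)) a := by
  simp [realize]

lemma realize_spread {f : (I →₀ ℤ) →ₗ[ℤ] (J →₀ ℤ)} (hf : Respects μ ν f) {x : X}
    {c : I →₀ ℤ} (hc : c ∈ above μ x) (a : F.obj x) :
    realize F μ ν f (spread F μ x c a) = spread F ν x (f c) a := by
  induction hc using above_induction with
  | single i hi => rw [spread_single F hi, realize_of, spread_transition F hi (hf i)]
  | zero => simp
  | add a b _ _ ha hb => simp [ha, hb]
  | smul m a _ ha =>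
    rw [map_smul, map_smul, map_smul, AddMonoidHom.smul_apply, AddMonoidHom.smul_apply, map_zsmul,
      ha]

/-- Realization discards matrix entries between labels that are not in order, so functoriality fails
for arbitrary maps. For maps that respect labels nothing is discarded. -/
lemma realize_comp {g : (J →₀ ℤ) →ₗ[ℤ] (K →₀ ℤ)} {f : (I →₀ ℤ) →ₗ[ℤ] (J →₀ ℤ)}
    (hg : Respects ν ξ g) (hf : Respects μ ν f) :
    (realize F ν ξ g).comp (realize F μ ν f) = realize F μ ξ (g ∘ₗ f) := by
  refine DirectSum.addHom_ext fun i a => ?_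
  rw [AddMonoidHom.comp_apply, realize_of, realize_of, realize_spread F hg (hf i)]
  rfl

lemma realize_id : realize F μ μ LinearMap.id = AddMonoidHom.id _ := by
  refine DirectSum.addHom_ext fun i a => ?_
  rw [realize_of, LinearMap.id_apply, spread_single_self, AddMonoidHom.id_apply]

lemma realize_zero : realize F μ ν 0 = 0 := by
  refine DirectSum.addHom_ext fun i a => ?_
  simp [realize_of]

lemma realize_add (f g : (I →₀ ℤ) →ₗ[ℤ] (J →₀ ℤ)) :
    realize F μ ν (f + g) = realize F μ ν f + realize F μ ν g := by
  refine DirectSum.addHom_ext fun i a => ?_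
  simp [realize_of]

lemma realize_sub (f g : (I →₀ ℤ) →ₗ[ℤ] (J →₀ ℤ)) :
    realize F μ ν (f - g) = realize F μ ν f - realize F μ ν g := by
  refine DirectSum.addHom_ext fun i a => ?_
  simp [realize_of]

end Labelled

/-! ### Comparison of labelled complexes -/

/-- A chain complex of free abelian groups with bases labelled by the elements of `X`, whose
differentials do not decrease labels. -/
structure LabelledComplex (X : Type u) [Preorder X] where
  /-- The basis in degree `n`. -/
  index : ℕ → Type u
  /-- The labels of the basis elements. -/
  label (n : ℕ) : index n → X
  /-- The differential. -/
  d (n : ℕ) : (index (n + 1) →₀ ℤ) →ₗ[ℤ] (index n →₀ ℤ)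
  respects (n : ℕ) : Respects (label (n + 1)) (label n) (d n)
  d_d (n : ℕ) : d n ∘ₗ d (n + 1) = 0

namespace LabelledComplex

variable {X : Type u} [Preorder X] (C D : LabelledComplex X)

/-- The subcomplexes of the vectors supported above any `x` that is not in `T` are acyclic. -/
structure AcyclicOff (T : Set X) : Prop where
  zero : ∀ x ∉ T, ∀ c ∈ above (D.label 0) x, ∃ b ∈ above (D.label 1) x, D.d 0 b = c
  succ : ∀ n, ∀ x ∉ T, ∀ c ∈ above (D.label (n + 1)) x, D.d n c = 0 →
    ∃ b ∈ above (D.label (n + 2)) x, D.d (n + 1) b = c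

variable {C D}

/-- The contraction `s` may depend on `x`, with no naturality, and the identities matter only on
basis vectors above `x`. They extend to all of `above _ x` by linearity. -/
lemma AcyclicOff.of_contraction {T : Set X}
    (s : ∀ x ∉ T, ∀ n, (D.index n →₀ ℤ) →ₗ[ℤ] (D.index (n + 1) →₀ ℤ))
    (mem : ∀ x hx n j, x ≤ D.label n j →
      s x hx n (Finsupp.single j 1) ∈ above (D.label (n + 1)) x)
    (zero : ∀ x hx j, x ≤ D.label 0 j →
      D.d 0 (s x hx 0 (Finsupp.single j 1)) = Finsupp.single j 1)
    (succ : ∀ x hx n j, x ≤ D.label (n + 1) j →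
      D.d (n + 1) (s x hx (n + 1) (Finsupp.single j 1)) +
        s x hx n (D.d n (Finsupp.single j 1)) = Finsupp.single j 1) : D.AcyclicOff T := by
  have mem' x hx n (c : D.index n →₀ ℤ) (hc : c ∈ above (D.label n) x) :
      s x hx n c ∈ above (D.label (n + 1)) x := by
    induction hc using above_induction with
    | single j h => exact mem x hx n j h
    | zero => simp
    | add a b _ _ ha hb => rw [map_add]; exact add_mem ha hb
    | smul k a _ ha => rw [map_smul]; exact Submodule.smul_mem _ _ ha
  refine ⟨fun x hx c hc => ⟨s x hx 0 c, mem' x hx 0 c hc, ?_⟩,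
    fun n x hx c hc hc' => ⟨s x hx (n + 1) c, mem' x hx _ c hc, ?_⟩⟩
  · induction hc using above_induction with
    | single j h => exact zero x hx j h
    | zero => simp
    | add a b _ _ ha hb => rw [map_add, map_add, ha, hb]
    | smul k a _ ha => rw [map_smul, map_smul, ha]
  · suffices h : D.d (n + 1) (s x hx (n + 1) c) + s x hx n (D.d n c) = c by
      rwa [hc', map_zero, add_zero] at h
    clear hc'
    induction hc using above_induction with
    | single j h => exact succ x hx n j h
    | zero => simp
    | add a b _ _ ha hb => simp only [map_add]; rw [add_add_add_comm, ha, hb]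
    | smul k a _ ha => simp only [map_smul]; rw [← smul_add, ha]

/-- Projectivity of free functors: a preimage is chosen for each basis vector, at the label of that
vector. -/
lemma exists_lift {n m : ℕ} (t : (C.index m →₀ ℤ) →ₗ[ℤ] (D.index n →₀ ℤ))
    (ht : ∀ i, ∃ b ∈ above (D.label (n + 1)) (C.label m i), D.d n b = t (Finsupp.single i 1)) :
    ∃ f : (C.index m →₀ ℤ) →ₗ[ℤ] (D.index (n + 1) →₀ ℤ),
      Respects (C.label m) (D.label (n + 1)) f ∧ D.d n ∘ₗ f = t := by
  choose b hb hb' using ht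
  refine ⟨Finsupp.linearCombination ℤ b, fun i => by simpa using hb i, ?_⟩
  ext1 i
  ext1
  simp [hb']

/-- A chain map can be extended from degree zero. -/
lemma exists_chainMap {T : Set X} (hD : D.AcyclicOff T) (hC : ∀ n i, C.label (n + 1) i ∉ T)
    (f₀ : (C.index 0 →₀ ℤ) →ₗ[ℤ] (D.index 0 →₀ ℤ)) (h₀ : Respects (C.label 0) (D.label 0) f₀) :
    ∃ f : ∀ n, (C.index n →₀ ℤ) →ₗ[ℤ] (D.index n →₀ ℤ), f 0 = f₀ ∧
      (∀ n, Respects (C.label n) (D.label n) (f n)) ∧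
      ∀ n, D.d n ∘ₗ f (n + 1) = f n ∘ₗ C.d n := by
  -- `Good` includes the solvability of the next lifting problem, so that the recursion carries one
  -- map at a time instead of a commuting pair.
  let Good (n : ℕ) (f : (C.index n →₀ ℤ) →ₗ[ℤ] (D.index n →₀ ℤ)) : Prop :=
    Respects (C.label n) (D.label n) f ∧ ∀ i, ∃ b ∈ above (D.label (n + 1)) (C.label (n + 1) i),
      D.d n b = (f ∘ₗ C.d n) (Finsupp.single i 1)
  have step : ∀ n (f : {f // Good n f}), ∃ f' : {f // Good (n + 1) f},
      D.d n ∘ₗ f'.1 = f.1 ∘ₗ C.d n := by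
    rintro n ⟨f, hf, hf'⟩
    obtain ⟨g, hg, hg'⟩ := exists_lift _ hf'
    refine ⟨⟨g, hg, fun i => hD.succ n _ (hC _ i) _ ((hg.comp (C.respects _)) i) ?_⟩, hg'⟩
    rw [← LinearMap.comp_apply, ← LinearMap.comp_assoc, hg', LinearMap.comp_assoc, C.d_d]
    simp
  choose next hnext using step
  have good₀ : Good 0 f₀ :=
    ⟨h₀, fun i => hD.zero _ (hC _ i) _ ((h₀.comp (C.respects 0)) i)⟩
  let f : ∀ n, {f // Good n f} := fun n => Nat.rec ⟨f₀, good₀⟩ next n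
  exact ⟨fun n => (f n).1, rfl, fun n => (f n).2.1, fun n => hnext n (f n)⟩

/-- A chain map that vanishes in degree zero is homotopic to zero. -/
lemma exists_homotopy {T : Set X} (hD : D.AcyclicOff T) (hC : ∀ n i, C.label (n + 1) i ∉ T)
    (e : ∀ n, (C.index n →₀ ℤ) →ₗ[ℤ] (D.index n →₀ ℤ))
    (he : ∀ n, Respects (C.label n) (D.label n) (e n))
    (comm : ∀ n, D.d n ∘ₗ e (n + 1) = e n ∘ₗ C.d n) (e₀ : e 0 = 0) :
    ∃ h : ∀ n, (C.index n →₀ ℤ) →ₗ[ℤ] (D.index (n + 1) →₀ ℤ),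
      (∀ n, Respects (C.label n) (D.label (n + 1)) (h n)) ∧ D.d 0 ∘ₗ h 0 = e 0 ∧
      ∀ n, h n ∘ₗ C.d n + D.d (n + 1) ∘ₗ h (n + 1) = e (n + 1) := by
  -- The second condition says that `e (n + 1) - h ∘ₗ C.d n` takes values in cycles, which
  -- acyclicity then lifts.
  let Good (n : ℕ) (h : (C.index n →₀ ℤ) →ₗ[ℤ] (D.index (n + 1) →₀ ℤ)) : Prop :=
    Respects (C.label n) (D.label (n + 1)) h ∧ D.d n ∘ₗ h ∘ₗ C.d n = e n ∘ₗ C.d n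
  have step : ∀ n (h : {h // Good n h}), ∃ h' : {h // Good (n + 1) h},
      h.1 ∘ₗ C.d n + D.d (n + 1) ∘ₗ h'.1 = e (n + 1) := by
    rintro n ⟨h, hh, hh'⟩
    have hr := (he (n + 1)).sub (hh.comp (C.respects n))
    have hz : D.d n ∘ₗ (e (n + 1) - h ∘ₗ C.d n) = 0 := by
      rw [LinearMap.comp_sub, hh', comm, sub_self]
    obtain ⟨g, hg, hg'⟩ := exists_lift _
      fun i => hD.succ n _ (hC _ i) _ (hr i) (LinearMap.congr_fun hz _)
    refine ⟨⟨g, hg, ?_⟩, ?_⟩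
    · rw [← LinearMap.comp_assoc, hg', LinearMap.sub_comp, LinearMap.comp_assoc, C.d_d,
        LinearMap.comp_zero, sub_zero]
    · rw [hg', add_sub_cancel]
  choose next hnext using step
  -- The homotopy can start with `0` because `e 0 = 0`. Basis elements of degree zero may have
  -- labels in `T`, where no lifting is available.
  have good₀ : Good 0 0 := ⟨Respects.zero, by simp [e₀]⟩
  let h : ∀ n, {h // Good n h} := fun n => Nat.rec ⟨0, good₀⟩ next n
  exact ⟨fun n => (h n).1, fun n => (h n).2.1, by simp [h, e₀], fun n => hnext n (h n)⟩

variable [∀ n, DecidableEq (C.index n)] [∀ n, DecidableEq (D.index n)]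
  (F : X ⥤ AddCommGrpCat.{v})

variable (C) in
/-- The chain complex `⨁ F(label i)`. -/
def toComplex : ChainComplex AddCommGrpCat.{max u v} ℕ :=
  ChainComplex.of (fun n => AddCommGrpCat.of (DirectSum (C.index n) fun i => F.obj (C.label n i)))
    (fun n => AddCommGrpCat.ofHom (realize F (C.label (n + 1)) (C.label n) (C.d n)))
    (fun n => by
      rw [← AddCommGrpCat.ofHom_comp, realize_comp F (C.respects n) (C.respects (n + 1)), C.d_d,
        realize_zero]
      rfl)

/-- The homomorphism between the groups of two realizations that is given by the matrix of `f`. -/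
def mapX {n m : ℕ} (f : (C.index n →₀ ℤ) →ₗ[ℤ] (D.index m →₀ ℤ)) :
    (C.toComplex F).X n ⟶ (D.toComplex F).X m :=
  AddCommGrpCat.ofHom (realize F (C.label n) (D.label m) f)

variable (C) in
lemma toComplex_d (n : ℕ) : (C.toComplex F).d (n + 1) n = mapX F (C.d n) :=
  ChainComplex.of_d (fun n => AddCommGrpCat.of (DirectSum (C.index n) fun i =>
    F.obj (C.label n i)))
    (fun n => AddCommGrpCat.ofHom (realize F (C.label (n + 1)) (C.label n) (C.d n))) n

lemma mapX_comp {E : LabelledComplex X} [∀ n, DecidableEq (E.index n)] {n m k : ℕ}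
    {f : (C.index n →₀ ℤ) →ₗ[ℤ] (D.index m →₀ ℤ)} {g : (D.index m →₀ ℤ) →ₗ[ℤ] (E.index k →₀ ℤ)}
    (hf : Respects (C.label n) (D.label m) f) (hg : Respects (D.label m) (E.label k) g) :
    mapX F f ≫ mapX F g = mapX F (g ∘ₗ f) :=
  congrArg AddCommGrpCat.ofHom (realize_comp F hg hf)

lemma mapX_add {n m : ℕ} (f g : (C.index n →₀ ℤ) →ₗ[ℤ] (D.index m →₀ ℤ)) :
    mapX F (f + g) = mapX F f + mapX F g :=
  congrArg AddCommGrpCat.ofHom (realize_add F f g)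

lemma mapX_sub {n m : ℕ} (f g : (C.index n →₀ ℤ) →ₗ[ℤ] (D.index m →₀ ℤ)) :
    mapX F (f - g) = mapX F f - mapX F g :=
  congrArg AddCommGrpCat.ofHom (realize_sub F f g)

lemma mapX_id (n : ℕ) :
    mapX F (LinearMap.id : (C.index n →₀ ℤ) →ₗ[ℤ] _) = 𝟙 ((C.toComplex F).X n) :=
  congrArg AddCommGrpCat.ofHom (realize_id F)

/-- The morphism of complexes induced by a label-preserving chain map. -/
def mapComplex (f : ∀ n, (C.index n →₀ ℤ) →ₗ[ℤ] (D.index n →₀ ℤ))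
    (hf : ∀ n, Respects (C.label n) (D.label n) (f n))
    (comm : ∀ n, D.d n ∘ₗ f (n + 1) = f n ∘ₗ C.d n) : C.toComplex F ⟶ D.toComplex F :=
  ChainComplex.ofHom (fun n => mapX F (f n)) fun n => by
    rw [toComplex_d, toComplex_d, mapX_comp F (hf (n + 1)) (D.respects n),
      mapX_comp F (C.respects n) (hf n), comm]

lemma mapComplex_f (f : ∀ n, (C.index n →₀ ℤ) →ₗ[ℤ] (D.index n →₀ ℤ)) (hf) (comm) (n : ℕ) :
    (mapComplex F f hf comm).f n = mapX F (f n) := rfl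

lemma homotopy_mapComplex
    {e : ∀ n, (C.index n →₀ ℤ) →ₗ[ℤ] (D.index n →₀ ℤ)} (he) (comm)
    (h : ∀ n, (C.index n →₀ ℤ) →ₗ[ℤ] (D.index (n + 1) →₀ ℤ))
    (hh : ∀ n, Respects (C.label n) (D.label (n + 1)) (h n)) (h₀ : D.d 0 ∘ₗ h 0 = e 0)
    (hs : ∀ n, h n ∘ₗ C.d n + D.d (n + 1) ∘ₗ h (n + 1) = e (n + 1)) :
    Nonempty (Homotopy (mapComplex F e he comm) 0) := by
  let H : ∀ i j, (ComplexShape.down ℕ).Rel j i →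
      ((C.toComplex F).X i ⟶ (D.toComplex F).X j) := fun i j hij => by
    obtain rfl : i + 1 = j := hij
    exact mapX F (h i)
  have key : mapComplex F e he comm = Homotopy.nullHomotopicMap' H := by
    ext1 n
    rw [mapComplex_f]
    cases n with
    | zero =>
      rw [Homotopy.nullHomotopicMap'_f_of_not_rel_left (k₁ := 1) rfl (by simp), toComplex_d]
      change _ = mapX F (h 0) ≫ _
      rw [mapX_comp F (hh _) (D.respects _), h₀]
    | succ n =>
      rw [Homotopy.nullHomotopicMap'_f (k₂ := n + 2) (k₀ := n) rfl rfl, toComplex_d, toComplex_d]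
      change _ = _ ≫ mapX F (h n) + mapX F (h (n + 1)) ≫ _
      rw [mapX_comp F (C.respects _) (hh _), mapX_comp F (hh _) (D.respects _), ← mapX_add, hs]
  rw [key]
  exact ⟨Homotopy.nullHomotopy' H⟩

/-- Two labelled complexes that are acyclic off `T`, have labels in `T` only in degree zero and
agree in degree zero have homotopy equivalent realizations. -/
theorem nonempty_homotopyEquiv {T : Set X} (hC : C.AcyclicOff T) (hD : D.AcyclicOff T)
    (hC' : ∀ n i, C.label (n + 1) i ∉ T) (hD' : ∀ n i, D.label (n + 1) i ∉ T)
    (s : C.index 0 ≃ D.index 0) (hs : ∀ i, D.label 0 (s i) = C.label 0 i) :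
    Nonempty (HomotopyEquiv (C.toComplex F) (D.toComplex F)) := by
  -- In degree zero `f` and `g` are the mutually inverse relabellings by `s` and `s.symm`, so `g ∘ f
  -- - id` and `f ∘ g - id` vanish there and `exists_homotopy` applies to them.
  obtain ⟨f, f₀, hf, f_comm⟩ := exists_chainMap hD hC'
    (Finsupp.domLCongr (R := ℤ) (M := ℤ) s).toLinearMap fun i => by
      simpa using single_mem_above (hs i).ge 1
  obtain ⟨g, g₀, hg, g_comm⟩ := exists_chainMap hC hD'
    (Finsupp.domLCongr (R := ℤ) (M := ℤ) s.symm).toLinearMap fun i => by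
      simpa using single_mem_above (by simpa using (hs (s.symm i)).le) 1
  have e_comm n : C.d n ∘ₗ (g (n + 1) ∘ₗ f (n + 1) - LinearMap.id) =
      (g n ∘ₗ f n - LinearMap.id) ∘ₗ C.d n := by
    rw [LinearMap.comp_sub, LinearMap.sub_comp, ← LinearMap.comp_assoc, g_comm,
      LinearMap.comp_assoc, f_comm, LinearMap.comp_assoc]
    rfl
  have e_comm' n : D.d n ∘ₗ (f (n + 1) ∘ₗ g (n + 1) - LinearMap.id) =
      (f n ∘ₗ g n - LinearMap.id) ∘ₗ D.d n := by
    rw [LinearMap.comp_sub, LinearMap.sub_comp, ← LinearMap.comp_assoc, f_comm,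
      LinearMap.comp_assoc, g_comm, LinearMap.comp_assoc]
    rfl
  have he n := ((hg n).comp (hf n)).sub Respects.id
  have he' n := ((hf n).comp (hg n)).sub Respects.id
  obtain ⟨h, hh, h0, h1⟩ := exists_homotopy hC hC' _ he e_comm (by
    rw [f₀, g₀]; ext1 i; ext1; simp)
  obtain ⟨k, hk, k0, k1⟩ := exists_homotopy hD hD' _ he' e_comm' (by
    rw [f₀, g₀]; ext1 i; ext1; simp)
  obtain ⟨H⟩ := homotopy_mapComplex F he e_comm h hh h0 h1
  obtain ⟨K⟩ := homotopy_mapComplex F he' e_comm' k hk k0 k1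
  refine ⟨⟨mapComplex F f hf f_comm, mapComplex F g hg g_comm,
    Homotopy.equivSubZero.symm ((Homotopy.ofEq ?_).trans H),
    Homotopy.equivSubZero.symm ((Homotopy.ofEq ?_).trans K)⟩⟩
  · ext1 n
    rw [HomologicalComplex.sub_f_apply, HomologicalComplex.comp_f, mapComplex_f, mapComplex_f,
      mapComplex_f, mapX_comp F (hf n) (hg n), mapX_sub, mapX_id, HomologicalComplex.id_f]
  · ext1 n
    rw [HomologicalComplex.sub_f_apply, HomologicalComplex.comp_f, mapComplex_f, mapComplex_f,
      mapComplex_f, mapX_comp F (hg n) (hf n), mapX_sub, mapX_id, HomologicalComplex.id_f]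

end LabelledComplex

/-! ### Recovering integral identities from realizations -/

section Detection

variable {X : Type u} [Preorder X] {I J : Type*} {μ : I → X} {ν : J → X}
  [DecidableEq I] [DecidableEq J]

/-- A label-preserving map is detected by its realization in the constant functor `ℤ`. -/
lemma eq_zero_of_realize_eq_zero {f : (I →₀ ℤ) →ₗ[ℤ] (J →₀ ℤ)} (hf : Respects μ ν f)
    (h : realize ((Functor.const X).obj (AddCommGrpCat.of ℤ)) μ ν f = 0) : f = 0 := by
  set Z : X ⥤ AddCommGrpCat := (Functor.const X).obj (AddCommGrpCat.of ℤ)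
  let e : (DirectSum J fun j => Z.obj (ν j)) →+ (J →₀ ℤ) :=
    DirectSum.toAddMonoid fun j => Finsupp.singleAddHom j
  -- All transitions of the constant functor are identities, and `spread` discards nothing from `c`,
  -- so evaluation at `1` returns the coefficients.
  have key (x : X) (c : J →₀ ℤ) (hc : c ∈ above ν x) : e (spread Z ν x c (1 : ℤ)) = c := by
    induction hc using above_induction with
    | single j hj =>
      rw [spread_single Z hj]
      exact DirectSum.toAddMonoid_of _ _ _
    | zero => simp
    | add a b _ _ ha hb => rw [map_add, AddMonoidHom.add_apply, map_add, ha, hb]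
    | smul m a _ ha => rw [map_smul, AddMonoidHom.smul_apply, map_zsmul, ha]
  ext1 i
  ext1
  refine (key (μ i) _ (hf i)).symm.trans ?_
  rw [← realize_of, h]
  simp

end Detection

/-! ### The cube complex -/

section Coordinates

variable {L : Type u} [BooleanAlgebra L] {r : ℕ} (φ : L ≃o (Fin r → Bool))

/-- The element whose coordinates are those of `x` except for the `m`-th, which is `b`. -/
def setCoord (m : Fin r) (b : Bool) (x : L) : L := φ.symm (Function.update (φ x) m b)

lemma apply_setCoord (m : Fin r) (b : Bool) (x : L) :
    φ (setCoord φ m b x) = Function.update (φ x) m b := by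
  simp [setCoord]

variable {φ}

lemma setCoord_covBy {m : Fin r} {x : L} (h : φ x m = true) : setCoord φ m false x ⋖ x :=
  covBy_of_flip φ (m := m) (by simp [apply_setCoord]) h fun j hj => by simp [apply_setCoord, hj]

lemma covBy_setCoord {m : Fin r} {x : L} (h : φ x m = false) : x ⋖ setCoord φ m true x :=
  covBy_of_flip φ (m := m) h (by simp [apply_setCoord]) fun j hj => by simp [apply_setCoord, hj]

lemma setCoord_setCoord (m : Fin r) {b c : Bool} {x : L} (h : φ x m = c) :
    setCoord φ m c (setCoord φ m b x) = x := by
  apply φ.injective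
  simp [apply_setCoord, ← h]

lemma le_setCoord {m : Fin r} {x y : L} (h : x ≤ y) (hm : φ x m = false) (b : Bool) :
    x ≤ setCoord φ m b y := by
  rw [← φ.le_iff_le, apply_setCoord]
  intro j
  rcases eq_or_ne j m with rfl | hj
  · simp [hm]
  · simpa [hj] using φ.monotone h j

lemma exists_coord_eq_false {x : L} (h : x ≠ ⊤) : ∃ m, φ x m = false := by
  by_contra! H
  refine h (φ.injective ?_)
  rw [map_top]
  funext j
  simpa using H j

lemma sign_mul_self {x y : L} (h : x ⋖ y) : sign φ h * sign φ h = 1 := by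
  unfold sign
  rw [← Finset.prod_mul_distrib]
  refine Finset.prod_eq_one fun j _ => ?_
  rw [← mul_pow]
  simp

/-- The elements `x` and `w` form a square with the two elements obtained by deleting `m`, and
`square` gives the anticommutation of its signs. -/
lemma sign_setCoord {m : Fin r} {x w : L} (hx : φ x m = true) (h : x ⋖ w) :
    ∃ (hw : φ w m = true) (h' : setCoord φ m false x ⋖ setCoord φ m false w),
      setCoord φ m false w ≠ x ∧ sign φ h' * sign φ (setCoord_covBy hw) =
        -(sign φ (setCoord_covBy hx) * sign φ h) := by
  have hw : φ w m = true := top_le_iff.1 (hx.symm.trans_le (φ.monotone h.le m))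
  have e : opposite φ (setCoord φ m false x) x w = setCoord φ m false w := by
    apply φ.injective
    funext j
    have hj : φ x j ≤ φ w j := φ.monotone h.le j
    rw [opposite_apply, apply_setCoord, apply_setCoord]
    rcases eq_or_ne j m with rfl | hne
    · simp [hx]
    · revert hj
      simp only [Function.update_of_ne hne]
      cases φ x j <;> cases φ w j <;> decide
  obtain ⟨h1, h2, h3, h4⟩ := square φ (setCoord_covBy hx) h
  revert h1 h2 h3 h4
  rw [e]
  exact fun h1 h2 h3 h4 => ⟨hw, h1, h3, h4⟩

/-- If the cover changes the coordinate `m`, it gives back `x`. -/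
lemma coord_eq_false {m : Fin r} {x y : L} (hx : φ x m = true) (h : setCoord φ m false x ⋖ y)
    (hy : y ≠ x) : φ y m = false := by
  by_contra hm
  have hf := flipIndex_eq φ h (m := m) (by rw [apply_setCoord]; simpa using Ne.symm hm)
  obtain ⟨-, h2, h3⟩ := flipIndex_spec φ h
  rw [hf] at h2 h3
  refine hy (φ.injective (funext fun j => ?_))
  rcases eq_or_ne j m with rfl | hj
  · rw [h2, hx]
  · rw [← h3 j hj, apply_setCoord, Function.update_of_ne hj]

/-- The coordinate changed by the cover differs from `m`, so the change commutes with restoring `m`.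
-/
lemma covBy_setCoord_of_ne {m : Fin r} {x y : L} (hx : φ x m = true)
    (h : setCoord φ m false x ⋖ y) (hy : y ≠ x) : x ⋖ setCoord φ m true y := by
  obtain ⟨h1, h2, h3⟩ := flipIndex_spec φ h
  have hm := coord_eq_false hx h hy
  have hne : flipIndex φ h ≠ m := fun e => by rw [e, hm] at h2; exact Bool.noConfusion h2
  simp only [apply_setCoord] at h1 h3
  refine covBy_of_flip φ (m := flipIndex φ h) (by simpa [hne] using h1)
    (by simpa [apply_setCoord, hne] using h2) fun j hj => ?_
  rcases eq_or_ne j m with rfl | hjm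
  · simp [apply_setCoord, hx]
  · simpa [apply_setCoord, hjm] using h3 j hj

/-- The elements other than `x` that cover `x` without its coordinate `m`. -/
def coverEquiv {m : Fin r} {x : L} (hx : φ x m = true) : {w : L // x ⋖ w} ≃
    {y : {y : L // setCoord φ m false x ⋖ y} // y ≠ ⟨x, setCoord_covBy hx⟩} where
  toFun w := ⟨⟨setCoord φ m false w.1, (sign_setCoord hx w.2).choose_spec.choose⟩,
    fun h => (sign_setCoord hx w.2).choose_spec.choose_spec.1 (congrArg Subtype.val h)⟩
  invFun y := ⟨setCoord φ m true y.1.1, covBy_setCoord_of_ne hx y.1.2 fun h => y.2 (Subtype.ext h)⟩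
  left_inv w := Subtype.ext (setCoord_setCoord m (sign_setCoord hx w.2).choose)
  right_inv y := Subtype.ext (Subtype.ext (setCoord_setCoord m
    (coord_eq_false hx y.1.2 fun h => y.2 (Subtype.ext h))))

end Coordinates

/-! ### Contractions of the cube complex by deletion of a coordinate -/

section Cube

variable {L : Type u} [BooleanAlgebra L] [Finite L] {r : ℕ} (φ : L ≃o (Fin r → Bool))

/-- The differential of the cube complex on basis elements. -/
def cubeD (n : ℕ) : (Level L (n + 1) →₀ ℤ) →ₗ[ℤ] (Level L n →₀ ℤ) :=
  Finsupp.linearCombination ℤ fun x => ∑ y : {y : L // x.1 ⋖ y},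
    sign φ y.2 • Finsupp.single (x.cover φ y) 1

lemma cubeD_single (n : ℕ) (x : Level L (n + 1)) :
    cubeD φ n (Finsupp.single x 1) = ∑ y : {y : L // x.1 ⋖ y},
      sign φ y.2 • Finsupp.single (x.cover φ y) 1 := by
  simp [cubeD]

lemma respects_cubeD (n : ℕ) : Respects (fun x : Level L (n + 1) => x.1)
    (fun x : Level L n => x.1) (cubeD φ n) := by
  intro x
  rw [cubeD_single]
  exact sum_mem fun y _ => Submodule.smul_mem _ _ 
    (single_mem_above (ν := fun x : Level L n => x.1) (j := x.cover φ y) y.2.le 1)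

lemma realize_cubeD (F : L ⥤ AddCommGrpCat.{v}) (n : ℕ) :
    realize F (fun x : Level L (n + 1) => x.1) (fun x : Level L n => x.1) (cubeD φ n) =
      cubeBoundary φ F n := by
  refine DirectSum.addHom_ext fun x a => ?_
  rw [realize_of, cubeD_single, cubeBoundary_of, map_sum, AddMonoidHom.finsetSum_apply]
  refine Finset.sum_congr rfl fun y _ => ?_
  rw [map_smul, AddMonoidHom.smul_apply,
    spread_single F (ν := fun x : Level L n => x.1) (j := x.cover φ y) y.2.le]

/-- The cube complex as a labelled complex. -/
def cubeLabelled : LabelledComplex L where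
  index n := Level L n
  label _ x := x.1
  d n := cubeD φ n
  respects n := respects_cubeD φ n
  d_d n := by
    -- The sign computation is already contained in `cubeBoundary_cubeBoundary`; its case of the
    -- constant functor `ℤ` yields the identity of matrices.
    refine eq_zero_of_realize_eq_zero ((respects_cubeD φ n).comp (respects_cubeD φ (n + 1))) ?_
    rw [← realize_comp _ (respects_cubeD φ n) (respects_cubeD φ (n + 1)), realize_cubeD,
      realize_cubeD, cubeBoundary_cubeBoundary]

/-- The homotopy that deletes the coordinate `m` from the elements that contain it. -/
def dropCoord (m : Fin r) (n : ℕ) : (Level L n →₀ ℤ) →ₗ[ℤ] (Level L (n + 1) →₀ ℤ) :=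
  Finsupp.linearCombination ℤ fun x => if h : φ x.1 m = true then
    sign φ (setCoord_covBy h) • Finsupp.single
      ⟨setCoord φ m false x.1, by have := x.2; have := rank_covBy φ (setCoord_covBy h); omega⟩ 1
    else 0

variable {φ}

omit [Finite L] in
lemma dropCoord_single {m : Fin r} {n : ℕ} {x : Level L n} (h : φ x.1 m = true) :
    dropCoord φ m n (Finsupp.single x 1) = sign φ (setCoord_covBy h) • Finsupp.single
      ⟨setCoord φ m false x.1,
        by have := x.2; have := rank_covBy φ (setCoord_covBy h); omega⟩ 1 := by
  simp [dropCoord, h]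

omit [Finite L] in
lemma dropCoord_single_of_false {m : Fin r} {n : ℕ} {x : Level L n} (h : φ x.1 m = false) :
    dropCoord φ m n (Finsupp.single x 1) = 0 := by
  simp [dropCoord, h]

omit [Finite L] in
lemma dropCoord_mem {m : Fin r} {n : ℕ} {x : L} (hx : φ x m = false) {y : Level L n}
    (h : x ≤ y.1) :
    dropCoord φ m n (Finsupp.single y 1) ∈ above (fun y : Level L (n + 1) => y.1) x := by
  cases hy : φ y.1 m with
  | false => rw [dropCoord_single_of_false hy]; exact zero_mem _
  | true =>
    rw [dropCoord_single hy]
    exact Submodule.smul_mem _ _ (Finsupp.single_mem_supported ℤ _ (le_setCoord h hx false))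

/-- Rank counts the coordinates equal to `1`, and an element other than `⊤` misses at least one. -/
lemma level_zero_eq_top (y : Level L 0) : y.1 = ⊤ := by
  obtain ⟨ψ⟩ := exists_cubeIso L
  by_contra hy
  obtain ⟨m, hm⟩ := exists_coord_eq_false (φ := ψ) hy
  refine ((rank_eq_card ψ y.1).symm.trans (y.2.trans (rank_eq_card ψ ⊤))).not_lt
    (Finset.card_lt_card ⟨fun j _ => ?_, fun hs => ?_⟩)
  · simp
  · simpa [hm] using hs (Finset.mem_filter.2 ⟨Finset.mem_univ m, by simp⟩)

/-- Among the covers of `x` without `m`, the element `x` itself contributes the square of a sign.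
The others correspond to the covers `w` of `x` by `coverEquiv`, and anticommutation produces the
minus sign. The remaining sum has the form of the one in `dropCoord_cubeD`, and the two cancel in
the contraction identity. -/
lemma cubeD_dropCoord {m : Fin r} {n : ℕ} (x : Level L n) (hx : φ x.1 m = true) :
    cubeD φ n (dropCoord φ m n (Finsupp.single x 1)) = Finsupp.single x 1 -
      ∑ w : {w : L // x.1 ⋖ w}, (sign φ w.2 *
        sign φ (setCoord_covBy (sign_setCoord hx w.2).choose)) •
          Finsupp.single (⟨setCoord φ m false w.1, by
            have := x.2
            have := rank_covBy φ w.2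
            have := rank_covBy φ (setCoord_covBy (sign_setCoord hx w.2).choose)
            omega⟩ : Level L n) 1 := by
  classical
  rw [dropCoord_single hx, map_smul, cubeD_single, Finset.smul_sum,
    Fintype.sum_eq_add_sum_subtype_ne _
      (⟨x.1, setCoord_covBy hx⟩ : {y : L // setCoord φ m false x.1 ⋖ y}), smul_smul,
    sign_mul_self, one_smul, sub_eq_add_neg, ← Finset.sum_neg_distrib]
  refine congrArg₂ _ rfl (Fintype.sum_equiv (coverEquiv hx) _ _ fun w => ?_).symm
  have := (sign_setCoord hx w.2).choose_spec.choose_spec.2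
  rw [smul_smul, ← neg_smul]
  refine congrArg₂ _ ?_ rfl
  -- Here `a` and `b` are the signs for deleting `m` from `x` and `w`, while `s` and `t` belong to
  -- the two other edges of the square, without and with `m`.
  have alg {a b s t : ℤ} (ha : a * a = 1) (hb : b * b = 1) (h : s * b = -(a * t)) :
      -(t * b) = a * s := by
    linear_combination -a * b * h + s * a * hb + t * b * ha
  exact alg (sign_mul_self (φ := φ) (setCoord_covBy hx)) (sign_mul_self (φ := φ) _) this

lemma dropCoord_cubeD (m : Fin r) (n : ℕ) (x : Level L (n + 1)) (hx : φ x.1 m = true) :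
    dropCoord φ m n (cubeD φ n (Finsupp.single x 1)) =
      ∑ w : {w : L // x.1 ⋖ w}, (sign φ w.2 *
        sign φ (setCoord_covBy (sign_setCoord hx w.2).choose)) •
          Finsupp.single (⟨setCoord φ m false w.1, by
            have := x.2
            have := rank_covBy φ w.2
            have := rank_covBy φ (setCoord_covBy (sign_setCoord hx w.2).choose)
            omega⟩ : Level L (n + 1)) 1 := by
  rw [cubeD_single, map_sum]
  refine Finset.sum_congr rfl fun w _ => ?_
  rw [map_smul, dropCoord_single (x := x.cover φ w) (sign_setCoord hx w.2).choose, smul_smul]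

/-- The only cover of `x` that contains `m` adds exactly `m`; deleting it again gives back `x` with
the square of a sign. -/
lemma dropCoord_cubeD_of_false (m : Fin r) (n : ℕ) (x : Level L (n + 1)) (hx : φ x.1 m = false) :
    dropCoord φ m n (cubeD φ n (Finsupp.single x 1)) = Finsupp.single x 1 := by
  rw [cubeD_single, map_sum,
    Fintype.sum_eq_single (⟨setCoord φ m true x.1, covBy_setCoord hx⟩ : {y : L // _ ⋖ y})]
  · have h : φ (setCoord φ m true x.1) m = true := by simp [apply_setCoord]
    have e : setCoord φ m false (setCoord φ m true x.1) = x.1 := setCoord_setCoord m hx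
    rw [map_smul, dropCoord_single (x := x.cover φ ⟨_, covBy_setCoord hx⟩) h, smul_smul]
    have aux (y : L) (hy : y = x.1) (hc : y ⋖ setCoord φ m true x.1) (hr) :
        (sign φ (covBy_setCoord hx) * sign φ hc) •
          Finsupp.single (⟨y, hr⟩ : Level L (n + 1)) (1 : ℤ) = Finsupp.single x 1 := by
      subst hy
      rw [sign_mul_self, one_smul]
    exact aux _ e _ _
  · intro y hy
    rw [map_smul, dropCoord_single_of_false, smul_zero]
    by_contra hm
    refine hy (Subtype.ext ?_)
    have hf := flipIndex_eq φ y.2 (m := m) (by rw [hx]; exact fun h => hm h.symm)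
    obtain ⟨-, h2, h3⟩ := flipIndex_spec φ y.2
    rw [hf] at h2 h3
    apply φ.injective
    funext j
    rw [apply_setCoord]
    rcases eq_or_ne j m with rfl | hj
    · simp [h2]
    · simp [hj, h3 j hj]

lemma acyclicOff_cubeLabelled (φ : L ≃o (Fin r → Bool)) :
    (cubeLabelled φ).AcyclicOff {⊤} := by
  have hex (x : L) (hx : x ∉ ({⊤} : Set L)) : ∃ m, φ x m = false := exists_coord_eq_false hx
  choose m hm using hex
  refine .of_contraction (fun x hx n => dropCoord φ (m x hx) n)
    (fun x hx n y h => dropCoord_mem (hm x hx) h) (fun x hx (y : Level L 0) _ => ?_)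
    (fun x hx n (y : Level L (n + 1)) _ => ?_)
  · have hy : φ y.1 (m x hx) = true := by rw [level_zero_eq_top, map_top]; rfl
    refine (cubeD_dropCoord y hy).trans ?_
    -- In degree zero `y` is `⊤`, which has no covers, so no correction term remains.
    have : IsEmpty {w : L // y.1 ⋖ w} :=
      ⟨fun w => not_top_lt ((level_zero_eq_top y).symm.trans_lt w.2.lt)⟩
    rw [Fintype.sum_empty, sub_zero]
    rfl
  · change cubeD φ (n + 1) (dropCoord φ _ (n + 1) (Finsupp.single y 1)) +
      dropCoord φ _ n (cubeD φ n (Finsupp.single y 1)) = Finsupp.single y 1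
    cases hy : φ y.1 (m x hx) with
    | false =>
      rw [dropCoord_cubeD_of_false _ _ _ hy, dropCoord_single_of_false hy, map_zero, zero_add]
    | true => rw [cubeD_dropCoord _ hy, dropCoord_cubeD _ _ _ hy, sub_add_cancel]

end Cube

/-! ### The complex of chains that end at the top element -/

section AbsoluteChains

variable {X : Type u} [Preorder X]

/-- The simplicial differential on chains with integral coefficients. -/
def chainD (n : ℕ) : (Chain X (n + 1) →₀ ℤ) →ₗ[ℤ] (Chain X n →₀ ℤ) :=
  Finsupp.linearCombination ℤ fun σ => ∑ i : Fin (n + 2),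
    (-1 : ℤ) ^ (i : ℕ) • Finsupp.single (σ.face i) 1

lemma chainD_single (n : ℕ) (σ : Chain X (n + 1)) :
    chainD n (Finsupp.single σ 1) = ∑ i : Fin (n + 2),
      (-1 : ℤ) ^ (i : ℕ) • Finsupp.single (σ.face i) 1 := by
  simp [chainD]

lemma respects_chainD (n : ℕ) : Respects (fun σ : Chain X (n + 1) => σ 0)
    (fun σ : Chain X n => σ 0) (chainD n) := by
  intro σ
  rw [chainD_single]
  exact sum_mem fun i _ => Submodule.smul_mem _ _
    (Finsupp.single_mem_supported ℤ _ (σ.zero_le_face i))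

lemma realize_chainD (F : X ⥤ AddCommGrpCat.{v}) (n : ℕ) :
    realize F (fun σ : Chain X (n + 1) => σ 0) (fun σ : Chain X n => σ 0) (chainD n) =
      boundary F n := by
  refine DirectSum.addHom_ext fun σ a => ?_
  rw [realize_of, chainD_single, boundary_of, map_sum, AddMonoidHom.finsetSum_apply]
  refine Finset.sum_congr rfl fun i _ => ?_
  rw [map_smul, AddMonoidHom.smul_apply,
    spread_single F (ν := fun σ : Chain X n => σ 0) (σ.zero_le_face i)]

lemma chainD_chainD (n : ℕ) : chainD n ∘ₗ chainD (X := X) (n + 1) = 0 := by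
  refine eq_zero_of_realize_eq_zero ((respects_chainD n).comp (respects_chainD (n + 1))) ?_
  rw [← realize_comp _ (respects_chainD n) (respects_chainD (n + 1)), realize_chainD,
    realize_chainD, boundary_boundary]

/-- The chain `x < σ 0 < ⋯ < σ n`. -/
def Chain.cons {n : ℕ} (x : X) (σ : Chain X n) (h : x < σ 0) : Chain X (n + 1) :=
  OrderEmbedding.ofStrictMono (Fin.cons x σ : Fin (n + 2) → X) <| by
    rw [Fin.strictMono_iff_lt_succ]
    intro i
    cases i using Fin.cases with
    | zero => simpa using h
    | succ i => simp

lemma Chain.cons_succ {n : ℕ} {x : X} {σ : Chain X n} (h : x < σ 0) (i : Fin (n + 1)) :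
    cons x σ h i.succ = σ i := rfl

lemma Chain.cons_last {n : ℕ} {x : X} {σ : Chain X n} (h : x < σ 0) :
    cons x σ h (Fin.last (n + 1)) = σ (Fin.last n) := rfl

lemma Chain.face_cons_zero {n : ℕ} {x : X} {σ : Chain X n} (h : x < σ 0) :
    (cons x σ h).face 0 = σ := by
  ext k
  exact cons_succ h k

lemma Chain.face_cons_succ {n : ℕ} {x : X} {σ : Chain X (n + 1)} (h : x < σ 0) (i : Fin (n + 2)) :
    (cons x σ h).face i.succ = cons x (σ.face i) (h.trans_le (σ.zero_le_face i)) := by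
  ext k
  change cons x σ h (i.succ.succAbove k) = _
  cases k using Fin.cases with
  | zero => rfl
  | succ k => rw [Fin.succ_succAbove_succ]; rfl

lemma Chain.cons_face_zero {n : ℕ} (σ : Chain X (n + 1)) (h : σ 0 < σ.face 0 0) :
    cons (σ 0) (σ.face 0) h = σ := by
  ext k
  cases k using Fin.cases <;> rfl

lemma Chain.face_succ_zero {n : ℕ} (σ : Chain X (n + 1)) (i : Fin (n + 1)) :
    σ.face i.succ 0 = σ 0 := rfl

end AbsoluteChains

/-! ### The complex on the chains with maximum `⊤` and its contractions -/

section RelativeChains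

variable {X : Type u} [PartialOrder X] [OrderTop X]

variable (X) in
/-- The chains with maximum `⊤`. -/
abbrev TopChain (n : ℕ) : Type u := {σ : Chain X n // σ (Fin.last n) = ⊤}

lemma Chain.last_eq_top_of_face {n : ℕ} {σ : Chain X (n + 1)} {i : Fin (n + 2)}
    (h : σ.face i (Fin.last n) = ⊤) : σ (Fin.last (n + 1)) = ⊤ :=
  top_le_iff.1 (h.symm.trans_le (σ.monotone (Fin.le_last _)))

/-- The projection that kills the chains whose maximum is not `⊤`. -/
def topProj (n : ℕ) : (Chain X n →₀ ℤ) →ₗ[ℤ] (TopChain X n →₀ ℤ) :=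
  open Classical in
  Finsupp.linearCombination ℤ fun σ => if h : σ (Fin.last n) = ⊤ then
    Finsupp.single ⟨σ, h⟩ 1 else 0

lemma topProj_single {n : ℕ} {σ : Chain X n} (h : σ (Fin.last n) = ⊤) :
    topProj n (Finsupp.single σ 1) = Finsupp.single ⟨σ, h⟩ 1 := by
  simp [topProj, h]

lemma topProj_single_of_ne {n : ℕ} {σ : Chain X n} (h : σ (Fin.last n) ≠ ⊤) :
    topProj n (Finsupp.single σ 1) = 0 := by
  simp [topProj, h]

/-- The inclusion of the group of chains with maximum `⊤`. -/
def topIncl (n : ℕ) : (TopChain X n →₀ ℤ) →ₗ[ℤ] (Chain X n →₀ ℤ) :=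
  Finsupp.linearCombination ℤ fun σ => Finsupp.single σ.1 1

lemma topIncl_single {n : ℕ} (σ : TopChain X n) :
    topIncl n (Finsupp.single σ 1) = Finsupp.single σ.1 1 := by
  simp [topIncl]

lemma respects_topProj (n : ℕ) : Respects (fun σ : Chain X n => σ 0)
    (fun σ : TopChain X n => σ.1 0) (topProj n) := by
  intro σ
  by_cases h : σ (Fin.last n) = ⊤
  · rw [topProj_single h]
    exact Finsupp.single_mem_supported ℤ _ (le_refl (σ 0))
  · rw [topProj_single_of_ne h]
    exact zero_mem _

lemma respects_topIncl (n : ℕ) : Respects (fun σ : TopChain X n => σ.1 0)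
    (fun σ : Chain X n => σ 0) (topIncl n) := by
  intro σ
  rw [topIncl_single]
  exact Finsupp.single_mem_supported ℤ _ (le_refl (σ.1 0))

lemma topProj_topIncl (n : ℕ) : topProj n ∘ₗ topIncl (X := X) n = LinearMap.id := by
  ext1 σ
  ext1
  change topProj n (topIncl n (Finsupp.single σ 1)) = Finsupp.single σ 1
  rw [topIncl_single, topProj_single σ.2]

/-- The differential of the relative complex on basis elements. -/
def topD (n : ℕ) : (TopChain X (n + 1) →₀ ℤ) →ₗ[ℤ] (TopChain X n →₀ ℤ) :=
  topProj n ∘ₗ chainD n ∘ₗ topIncl (n + 1)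

lemma topD_single (n : ℕ) (σ : TopChain X (n + 1)) :
    topD n (Finsupp.single σ 1) = ∑ i : Fin (n + 2),
      (-1 : ℤ) ^ (i : ℕ) • topProj n (Finsupp.single (σ.1.face i) 1) := by
  change topProj n (chainD n (topIncl (n + 1) (Finsupp.single σ 1))) = _
  rw [topIncl_single, chainD_single, map_sum]
  simp only [map_smul]

lemma respects_topD (n : ℕ) : Respects (fun σ : TopChain X (n + 1) => σ.1 0)
    (fun σ : TopChain X n => σ.1 0) (topD n) :=
  (respects_topProj n).comp ((respects_chainD n).comp (respects_topIncl (n + 1)))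

/-- The chains whose maximum is not `⊤` are closed under faces, so killing them is compatible with
the differentials. The inclusion `topIncl` has no such property, since removing the last element of
a chain can leave these chains. -/
lemma topD_topProj (n : ℕ) : topD n ∘ₗ topProj (X := X) (n + 1) = topProj n ∘ₗ chainD n := by
  ext1 σ
  ext1
  change topD n (topProj (n + 1) (Finsupp.single σ 1)) = topProj n (chainD n (Finsupp.single σ 1))
  rw [chainD_single, map_sum]
  by_cases h : σ (Fin.last (n + 1)) = ⊤
  · rw [topProj_single h, topD_single]
    simp only [map_smul]
  · rw [topProj_single_of_ne h, map_zero]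
    refine (Finset.sum_eq_zero fun i _ => ?_).symm
    rw [map_smul, topProj_single_of_ne (fun h' => h (Chain.last_eq_top_of_face h')), smul_zero]

variable (X) in
/-- The relative chain complex as a labelled complex. -/
def topLabelled : LabelledComplex X where
  index n := TopChain X n
  label _ σ := σ.1 0
  d n := topD n
  respects n := respects_topD n
  d_d n := by
    change topD n ∘ₗ topProj (n + 1) ∘ₗ chainD (n + 1) ∘ₗ topIncl (n + 2) = 0
    rw [← LinearMap.comp_assoc, topD_topProj, LinearMap.comp_assoc,
      ← LinearMap.comp_assoc (topIncl (n + 2)), chainD_chainD, LinearMap.zero_comp,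
      LinearMap.comp_zero]

/-- The homotopy that prepends `x` to the chains with minimum larger than `x`. -/
def prepend (x : X) (n : ℕ) : (TopChain X n →₀ ℤ) →ₗ[ℤ] (TopChain X (n + 1) →₀ ℤ) :=
  open Classical in
  Finsupp.linearCombination ℤ fun σ => if h : x < σ.1 0 then
    Finsupp.single ⟨σ.1.cons x h, σ.2⟩ 1 else 0

lemma prepend_single {x : X} {n : ℕ} {σ : TopChain X n} (h : x < σ.1 0) :
    prepend x n (Finsupp.single σ 1) = Finsupp.single ⟨σ.1.cons x h, σ.2⟩ 1 := by
  simp [prepend, h]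

lemma prepend_single_of_not_lt {x : X} {n : ℕ} {σ : TopChain X n} (h : ¬ x < σ.1 0) :
    prepend x n (Finsupp.single σ 1) = 0 := by
  simp [prepend, h]

lemma prepend_topProj {x : X} {n : ℕ} {σ : Chain X n} (h : x < σ 0) :
    prepend x n (topProj n (Finsupp.single σ 1)) =
      topProj (n + 1) (Finsupp.single (σ.cons x h) 1) := by
  by_cases h' : σ (Fin.last n) = ⊤
  · rw [topProj_single h', topProj_single (by rwa [Chain.cons_last]), prepend_single]
  · rw [topProj_single_of_ne h', topProj_single_of_ne (by rwa [Chain.cons_last]), map_zero]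

lemma prepend_topProj_of_not_lt {x : X} {n : ℕ} {σ : Chain X n} (h : ¬ x < σ 0) :
    prepend x n (topProj n (Finsupp.single σ 1)) = 0 := by
  by_cases h' : σ (Fin.last n) = ⊤
  · rw [topProj_single h', prepend_single_of_not_lt h]
  · rw [topProj_single_of_ne h', map_zero]

/-- This is the contraction of a cone with apex `x`. If `x < σ 0`, the zeroth face of the extended
chain is `σ`, and its other faces cancel against the extended faces of `σ`. If `x = σ 0`, then `σ`
is sent to `0`, its zeroth face is extended back to `σ`, and its other faces still start with `x`
and are killed. -/
lemma acyclicOff_topLabelled : (topLabelled X).AcyclicOff {⊤} := by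
  refine .of_contraction (fun x _ n => prepend x n) (fun x _ n (σ : TopChain X n) _ => ?_)
    (fun x hx (σ : TopChain X 0) _ => ?_) (fun x hx n (σ : TopChain X (n + 1)) hσ => ?_)
  · change prepend x n (Finsupp.single σ 1) ∈ above (fun σ : TopChain X (n + 1) => σ.1 0) x
    by_cases h : x < σ.1 0
    · rw [prepend_single h]
      exact Finsupp.single_mem_supported ℤ _ (le_refl x)
    · rw [prepend_single_of_not_lt h]
      exact zero_mem _
  -- The chain `σ` is `⊤` alone. The other face of `x < ⊤` is the chain `x`, which vanishes in the
  -- quotient because `x ≠ ⊤`.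
  · have h : x < σ.1 0 := (lt_top_iff_ne_top.2 hx).trans_eq σ.2.symm
    change topD 0 (prepend x 0 (Finsupp.single σ 1)) = Finsupp.single σ 1
    rw [prepend_single h, topD_single, Fin.sum_univ_two, Chain.face_cons_zero, topProj_single σ.2,
      topProj_single_of_ne]
    · simp
    · exact hx
  · change topD (n + 1) (prepend x (n + 1) (Finsupp.single σ 1)) +
      prepend x n (topD n (Finsupp.single σ 1)) = Finsupp.single σ 1
    rw [topD_single n, map_sum]
    simp only [map_smul]
    rcases lt_or_eq_of_le (show x ≤ σ.1 0 from hσ) with h | h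
    · rw [prepend_single h, topD_single, Fin.sum_univ_succ, Chain.face_cons_zero,
        topProj_single σ.2, add_assoc, ← Finset.sum_add_distrib, Finset.sum_eq_zero]
      · simp
      · intro i _
        rw [Chain.face_cons_succ, prepend_topProj (h.trans_le (σ.1.zero_le_face i)), Fin.val_succ,
          pow_succ]
        simp
    · subst h
      have h : σ.1 0 < σ.1.face 0 0 := σ.1.strictMono (Fin.succ_pos 0)
      rw [prepend_single_of_not_lt (lt_irrefl _), map_zero, zero_add, Fin.sum_univ_succ,
        prepend_topProj h, Chain.cons_face_zero, topProj_single σ.2, Finset.sum_eq_zero]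
      · simp
      · intro i _
        rw [prepend_topProj_of_not_lt (by rw [Chain.face_succ_zero]; exact lt_irrefl _), smul_zero]

end RelativeChains

/-! ### Identification of the relative complex -/

section Relative

variable {X : Type u} [PartialOrder X] [OrderTop X] (F : X ⥤ AddCommGrpCat.{v})

instance (n : ℕ) : DecidableEq ((topLabelled X).index n) :=
  inferInstanceAs (DecidableEq (TopChain X n))

/-- The projection to the sum over the chains with maximum `⊤`. -/
def topProjHom (n : ℕ) : ChainGroup F n →+ DirectSum (TopChain X n) fun σ => F.obj (σ.1 0) :=
  realize F (fun σ : Chain X n => σ 0) (fun σ : TopChain X n => σ.1 0) (topProj n)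

/-- The inclusion of the sum over the chains with maximum `⊤`. -/
def topInclHom (n : ℕ) : (DirectSum (TopChain X n) fun σ => F.obj (σ.1 0)) →+ ChainGroup F n :=
  realize F (fun σ : TopChain X n => σ.1 0) (fun σ : Chain X n => σ 0) (topIncl n)

lemma topProjHom_topInclHom (n : ℕ) :
    (topProjHom F n).comp (topInclHom F n) = AddMonoidHom.id _ := by
  unfold topProjHom topInclHom
  rw [realize_comp F (respects_topProj n) (respects_topIncl n), topProj_topIncl, realize_id]

lemma topProjHom_of_ne {n : ℕ} {σ : Chain X n} (h : σ (Fin.last n) ≠ ⊤) (a : F.obj (σ 0)) :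
    topProjHom F n (DirectSum.of (fun τ : Chain X n => F.obj (τ 0)) σ a) = 0 := by
  rw [topProjHom, realize_of, topProj_single_of_ne h, LinearMap.map_zero, AddMonoidHom.zero_apply]

lemma topInclHom_topProjHom_of {n : ℕ} {σ : Chain X n} (h : σ (Fin.last n) = ⊤)
    (a : F.obj (σ 0)) :
    topInclHom F n (topProjHom F n (DirectSum.of (fun τ : Chain X n => F.obj (τ 0)) σ a)) =
      DirectSum.of (fun τ : Chain X n => F.obj (τ 0)) σ a := by
  rw [topProjHom, realize_of, topProj_single h, topInclHom, realize_spread F (respects_topIncl n)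
    (Finsupp.single_mem_supported ℤ _ (le_refl (σ 0))), topIncl_single]
  exact spread_single_self F (ν := fun τ : Chain X n => τ 0) σ a

lemma topProjHom_comp_inclusionHom (n : ℕ) :
    (topProjHom F n).comp (inclusionHom F ({⊤}ᶜ : Set X) n) = 0 := by
  refine DirectSum.addHom_ext fun σ a => ?_
  rw [AddMonoidHom.comp_apply, inclusionHom_of]
  exact topProjHom_of_ne F (σ := Chain.incl _ σ) (σ (Fin.last n)).2 _

/-- A chain whose maximum is not `⊤`, as a chain of the complement of `⊤`. -/
def Chain.lift {n : ℕ} (σ : Chain X n) (h : σ (Fin.last n) ≠ ⊤) : Chain ({⊤}ᶜ : Set X) n :=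
  OrderEmbedding.ofStrictMono
    (fun i => ⟨σ i, ne_top_of_le_ne_top h (σ.monotone (Fin.le_last i))⟩)
    fun _ _ hij => σ.strictMono hij

/-- The difference keeps exactly the summands of chains whose maximum is not `⊤`, and these chains
avoid `⊤` altogether. -/
lemma sub_mem_range_inclusionHom (n : ℕ) (z : ChainGroup F n) :
    z - topInclHom F n (topProjHom F n z) ∈ (inclusionHom F ({⊤}ᶜ : Set X) n).range := by
  induction z using DirectSum.induction_on with
  | zero => simp
  | of σ a =>
    by_cases h : σ (Fin.last n) = ⊤
    · rw [topInclHom_topProjHom_of F h, sub_self]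
      exact zero_mem _
    · rw [topProjHom_of_ne F h, (topInclHom F n).map_zero, sub_zero]
      exact ⟨DirectSum.of (fun τ : Chain ({⊤}ᶜ : Set X) n => (restrict F {⊤}ᶜ).obj (τ 0))
        (σ.lift h) a, inclusionHom_of F _ n _ _⟩
  | add x y hx hy =>
    rw [map_add, map_add, add_sub_add_comm]
    exact add_mem hx hy

/-- The projection of the chain complex to its quotient on the chains with maximum `⊤`. -/
def topProjComplex : chainComplex F ⟶ (topLabelled X).toComplex F :=
  ChainComplex.ofHom (fun n => AddCommGrpCat.ofHom (topProjHom F n)) fun n => by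
    rw [chainComplex_d, LabelledComplex.toComplex_d]
    refine congrArg AddCommGrpCat.ofHom (?_ : (realize F (fun σ : TopChain X (n + 1) => σ.1 0)
      (fun σ : TopChain X n => σ.1 0) (topD n)).comp (topProjHom F (n + 1)) =
        (topProjHom F n).comp (boundary F n))
    rw [← realize_chainD]
    unfold topProjHom
    rw [realize_comp F (respects_topD n) (respects_topProj (n + 1)),
      realize_comp F (respects_topProj n) (respects_chainD n), topD_topProj]

lemma inclusion_comp_topProjComplex :
    inclusion F ({⊤}ᶜ : Set X) ≫ topProjComplex F = 0 := by
  ext1 n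
  exact congrArg AddCommGrpCat.ofHom (topProjHom_comp_inclusionHom F n)

/-- Together with surjectivity of the projection this identifies the cokernel; injectivity of the
inclusion plays no role. -/
lemma exact_inclusion_topProjComplex :
    (ShortComplex.mk _ _ (inclusion_comp_topProjComplex F)).Exact := by
  refine HomologicalComplex.exact_of_degreewise_exact _ fun n => ?_
  rw [ShortComplex.ab_exact_iff]
  intro (z : ChainGroup F n) (hz : topProjHom F n z = 0)
  obtain ⟨w, hw⟩ := sub_mem_range_inclusionHom F n z
  rw [hz, map_zero, sub_zero] at hw
  exact ⟨w, hw⟩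

instance epi_topProjComplex : Epi (topProjComplex F) := by
  refine HomologicalComplex.epi_of_epi_f _ fun n => ?_
  rw [AddCommGrpCat.epi_iff_surjective]
  exact fun z => ⟨topInclHom F n z, DFunLike.congr_fun (topProjHom_topInclHom F n) z⟩

/-- The relative complex of the pair `(X, X \ {⊤})` has one summand for each chain with
maximum `⊤`. -/
def relativeComplexIso : relativeComplex F ({⊤}ᶜ : Set X) ≅ (topLabelled X).toComplex F :=
  have : Epi (ShortComplex.mk _ _ (inclusion_comp_topProjComplex F)).g := epi_topProjComplex F
  (Limits.cokernelIsCokernel (inclusion F ({⊤}ᶜ : Set X))).coconePointUniqueUpToIso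
    (exact_inclusion_topProjComplex F).gIsCokernel

end Relative

/-! ### Passage to homology and comparison in degree zero -/

lemma nonempty_homologyInt_iso {K K' : ChainComplex AddCommGrpCat.{u} ℕ}
    (e : HomotopyEquiv K K') (n : ℤ) : Nonempty (homologyInt K n ≅ homologyInt K' n) :=
  have : QuasiIso e.hom := inferInstance
  ⟨isoOfQuasiIsoAt (HomologicalComplex.extendMap e.hom natToInt) n⟩

section Final

variable {L : Type u} [BooleanAlgebra L] [Finite L]

instance {r : ℕ} (φ : L ≃o (Fin r → Bool)) (n : ℕ) : DecidableEq ((cubeLabelled φ).index n) :=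
  inferInstanceAs (DecidableEq (Level L n))

lemma toComplex_cubeLabelled (φ : L ≃o (Fin (rank (⊤ : L)) → Bool)) (F : L ⥤ AddCommGrpCat.{v}) :
    (cubeLabelled φ).toComplex F = cubeComplex φ F := by
  have h : (fun n => AddCommGrpCat.ofHom (realize F (fun x : Level L (n + 1) => x.1)
      (fun x : Level L n => x.1) (cubeD φ n))) =
      fun n => AddCommGrpCat.ofHom (cubeBoundary φ F n) := by
    funext n
    rw [realize_cubeD]
  unfold cubeComplex
  -- The differentials are replaced as a whole family, so that the proof that they square to zero is
  -- carried along.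
  simp only [← h]
  rfl

/-- The chain `⊤` is the only one of length zero with maximum `⊤`, and `⊤` is the only element of
maximal rank. -/
def topChainZeroEquiv : TopChain L 0 ≃ Level L 0 where
  toFun _ := ⟨⊤, rfl⟩
  invFun _ := ⟨OrderEmbedding.ofStrictMono (fun _ => ⊤) fun i j h => absurd h (by simp), rfl⟩
  left_inv σ := by
    ext i
    obtain rfl : i = Fin.last 0 := Fin.eq_zero i
    exact σ.2.symm
  right_inv x := Subtype.ext (level_zero_eq_top x).symm

end Final

end

end PosetHomology

open PosetHomology in
theorem mainTheorem2 {L : Type u} [BooleanAlgebra L] [Finite L]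
    (φ : L ≃o (Fin (PosetHomology.rank (⊤ : L)) → Bool))
    (F : L ⥤ AddCommGrpCat.{v}) (n : ℤ) :
    Nonempty (PosetHomology.relativeHomology F ({⊤}ᶜ : Set L) n ≅
      PosetHomology.homologyInt (PosetHomology.cubeComplex φ F) n) := by
  -- In positive degrees no label is `⊤`: a chain of at least two elements starts below its maximum,
  -- and an element of `Level L (n + 1)` has rank less than that of `⊤`.
  have hR (n : ℕ) (σ : TopChain L (n + 1)) : σ.1 0 ≠ ⊤ :=
    ((σ.1.strictMono (Fin.last_pos)).trans_le le_top).ne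
  have hE (n : ℕ) (x : Level L (n + 1)) : x.1 ≠ ⊤ := fun h => by
    have := x.2
    rw [h] at this
    omega
  -- In degree zero the minimum of a chain is its maximum, so `σ.2` also says that its label is `⊤`.
  obtain ⟨e⟩ := LabelledComplex.nonempty_homotopyEquiv F acyclicOff_topLabelled
    (acyclicOff_cubeLabelled φ) hR hE topChainZeroEquiv fun σ => σ.2.symm
  rw [toComplex_cubeLabelled] at e
  exact nonempty_homologyInt_iso ((HomotopyEquiv.ofIso (relativeComplexIso F)).trans e) n
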